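/- Work in the piecewise linear (PL) category. A closed $n$-manifold is a compact polyhedron $M\subset\mathbb R^N$ (the underlying space of a finite simplicial complex), for some $N$, in which every point has a neighbourhood PL homeomorphic to the cube $[-1,1]^n$ by a homeomorphism sending the point to the centre; connectedness is not required. A (loose) triangulation of $M$ is a realization of $M$, up to PL homeomorphism, as the space obtained from finitely many copies of the standard $n$-simplex by glueing their facets along a simplicial pairing of the facets (distinct facets are identified in pairs by simplicial isomorphisms). Let $\sigma(M)$ be the minimal number of $n$-simplices in a loose triangulation of $M$, and let $$\sigma_\infty(M)=\inf_{\widetilde M\stackrel{d}{\to}M}\frac{\sigma(\widetilde M)}{d},$$ where the infimum is taken over all PL coverings $\widetilde M\to M$ of any finite degree $d\ge 1$ by closed $n$-manifolds $\widetilde M$ (not necessarily connected). Let $\chi(M)$ be the Euler characteristic, the alternating sum of the dimensions of the rational singular homology groups of $M$. For every $n\ge 0$ and every closed $n$-manifold $M$, $$|\chi(M)|\le 2^{n+1}\,\sigma_\infty(M).$$ In particular, if $\sigma_\infty(M)=0$ then $\chi(M)=0$. -/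

import Mathlib

open Set Topology
open scoped ENNReal

/-! ### Compact polyhedra and piecewise linear maps -/

/-- A compact polyhedron in `ℝᴺ`: the underlying space of a finite geometric simplicial complex. -/
def IsCompactPolyhedron {N : ℕ} (X : Set (Fin N → ℝ)) : Prop :=
  ∃ K : Geometry.SimplicialComplex ℝ (Fin N → ℝ), K.faces.Finite ∧ K.space = X

/-- A map `f : X → ℝᴸ` from a compact polyhedron `X ⊆ ℝᴺ` is piecewise linear if `X` has a finite
simplicial subdivision such that `f` is affine on every simplex of it. A map into a subset `Y` of
`ℝᴸ` is piecewise linear if it is so as a map to `ℝᴸ`. -/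
def IsPLMap {N L : ℕ} {X : Set (Fin N → ℝ)} (f : X → (Fin L → ℝ)) : Prop :=
  ∃ K : Geometry.SimplicialComplex ℝ (Fin N → ℝ), K.faces.Finite ∧ K.space = X ∧
    ∀ s ∈ K.faces, ∃ A : (Fin N → ℝ) →ᵃ[ℝ] (Fin L → ℝ),
      ∀ x : X, (x : Fin N → ℝ) ∈ convexHull ℝ (s : Set (Fin N → ℝ)) → f x = A x

/-- A closed piecewise linear `n`-manifold (compact, without boundary, not necessarily connected):
a compact polyhedron in which every point `x` has a (closed) neighbourhood `U` together with a
piecewise linear homeomorphism from `U` to the cube `[-1, 1]ⁿ` sending `x` to the centre. -/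
structure IsClosedPLManifold (n : ℕ) {N : ℕ} (M : Set (Fin N → ℝ)) : Prop where
  isCompactPolyhedron : IsCompactPolyhedron M
  exists_chart : ∀ x ∈ M, ∃ (U : Set (Fin N → ℝ)) (hx : x ∈ U)
    (h : U ≃ₜ (Icc (-1) 1 : Set (Fin n → ℝ))),
    U ⊆ M ∧ U ∈ 𝓝[M] x ∧ IsPLMap (fun u => (h u : Fin n → ℝ)) ∧
      (h ⟨x, hx⟩ : Fin n → ℝ) = 0

/-! ### Loose triangulations -/

/-- A simplicial pairing of the facets of `m` copies of the standard `n`-simplex. The pair `(i, k)`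
stands for the facet of the `i`-th simplex opposite to its `k`-th vertex. The facet `F` is paired
with `pair F`, and the identification of the two is the simplicial isomorphism that sends the vertex
`l ≠ F.2` to the vertex `glue F l`; the permutation `glue F` sends the vertex that is opposite
to `F` to the one that is opposite to `pair F`. No facet is paired with itself, except for `n = 0`,
where facets are empty and their pairing has no meaning. -/
structure FacetPairing (n m : ℕ) where
  pair : Fin m × Fin (n + 1) → Fin m × Fin (n + 1)
  glue : Fin m × Fin (n + 1) → Equiv.Perm (Fin (n + 1))
  pair_pair : ∀ F, pair (pair F) = F
  pair_ne : n ≠ 0 → ∀ F, pair F ≠ F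
  glue_opposite : ∀ F, glue F F.2 = (pair F).2
  glue_pair : ∀ F, glue (pair F) = (glue F)⁻¹

namespace FacetPairing

variable {n m : ℕ}

/-- The elementary identifications: a point of a facet is identified with the point of the paired
facet that has the corresponding barycentric coordinates. -/
def Rel (T : FacetPairing n m) (a b : Fin m × stdSimplex ℝ (Fin (n + 1))) : Prop :=
  ∃ k : Fin (n + 1), a.2 k = 0 ∧ b.1 = (T.pair (a.1, k)).1 ∧
    ∀ l, b.2 (T.glue (a.1, k) l) = a.2 l

/-- The space obtained from `m` disjoint copies of the standard `n`-simplex by glueing their facets: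
the quotient, with the quotient topology, by the equivalence relation that `T.Rel` generates. -/
abbrev Realization (T : FacetPairing n m) : Type := Quot T.Rel

/-- `T` is a (loose) triangulation of `M`: there is a piecewise linear homeomorphism from the space
glued according to `T` to `M`, that is, one whose restriction to every simplex is piecewise
linear. -/
def Triangulates (T : FacetPairing n m) {N : ℕ} (M : Set (Fin N → ℝ)) : Prop :=
  ∃ h : T.Realization ≃ₜ M, ∀ i : Fin m,
    IsPLMap (fun x : stdSimplex ℝ (Fin (n + 1)) => (h (Quot.mk _ (i, x)) : Fin N → ℝ))

end FacetPairing

/-- The `Δ`-complexity `σ(M)` of a closed `n`-manifold: the least number of `n`-simplices in a loose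
triangulation of `M` (`⊤` if there were none). -/
noncomputable def deltaComplexity (n : ℕ) {N : ℕ} (M : Set (Fin N → ℝ)) : ℕ∞ :=
  ⨅ (m : ℕ) (_ : ∃ T : FacetPairing n m, T.Triangulates M), (m : ℕ∞)

/-! ### Coverings and the stable complexity -/

/-- `p : M' → M` is a piecewise linear covering of finite degree `d ≥ 1`. -/
structure IsPLCovering {N' N : ℕ} {M' : Set (Fin N' → ℝ)} {M : Set (Fin N → ℝ)}
    (p : M' → M) (d : ℕ) : Prop where
  isPLMap : IsPLMap (fun x => (p x : Fin N → ℝ))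
  isCoveringMap : IsCoveringMap p
  degree_pos : 0 < d
  ncard_fiber : ∀ y : M, (p ⁻¹' {y}).ncard = d

/-- The stable `Δ`-complexity `σ_∞(M)` of a closed `n`-manifold: the infimum of `σ(M') / d` over all
coverings `M' → M` of all finite degrees `d` by closed `n`-manifolds `M'`. -/
noncomputable def stableDeltaComplexity (n : ℕ) {N : ℕ} (M : Set (Fin N → ℝ)) : ℝ≥0∞ :=
  ⨅ (N' : ℕ) (M' : Set (Fin N' → ℝ)) (_ : IsClosedPLManifold n M')
    (p : M' → M) (d : ℕ) (_ : IsPLCovering p d), (deltaComplexity n M' : ℝ≥0∞) / (d : ℝ≥0∞)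

/-! ### The Euler characteristic -/

/-- The Euler characteristic of a space: the alternating sum of the dimensions of its singular
homology groups with rational coefficients. -/
noncomputable def eulerCharacteristic (X : Type) [TopologicalSpace X] : ℤ :=
  (((AlgebraicTopology.singularChainComplexFunctor (ModuleCat.{0} ℚ)).obj
    (ModuleCat.of ℚ ℚ)).obj (TopCat.of X)).homologyEulerChar

/-! Two facts give the bound. The Euler characteristic is multiplicative: a covering `M' → M` of
degree `d` has `χ(M') = d χ(M)`. And a T1 space glued from `m` simplices of dimension `n` satisfies
`|χ| ≤ 2 ^ (n + 1) * m`. Together, `|χ(M)| d ≤ 2 ^ (n + 1) σ(M')` for every covering.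

Both facts rest on `hasEuler_of_cover`: if a finite open cover has intersections that deformation
retract to finite sets, then `χ` is the alternating sum of the cardinalities of these sets. This
follows from Mayer-Vietoris, which is proved by iterated barycentric subdivision of singular chains.

For multiplicativity, the base is covered by the open stars of the vertices of a triangulation.
Their intersections contract to barycenters of faces; the contractions lift to the covering space,
where the retract is a fibre of `d` points (`hasEuler_covering`).

For the glued space, counting faces is not enough: a loose glueing may identify a face with itself
by a nontrivial symmetry, so the image of an open face may be a quotient of a cell by a finite
group. In barycentric terms, let the open set of index `s` consist of the points whose `s` greatest
coordinates are positive and set apart from the rest. The intersection over `s ∈ S` retracts to the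
finitely many points given by flags of faces with sizes `S`. These terms are grouped by the size `j`
of the greatest member of the flag. The points then correspond to the orbits of the symmetric group
on pairs (ordered face with `j` vertices, flag on `j` letters containing the full set), and
Burnside's lemma expresses `j!` times the contribution of `j` as a sum over permutations `g` of the
number of fixed ordered faces times the alternating number of fixed flags. The latter is, up to
sign, the Möbius function of the lattice of `g`-invariant sets. This lattice is Boolean on the
cycles of `g`, so the value is `1` or `-1` (`natAbs_flagSum_smul`). A second use of Burnside bounds
the contribution by the number of face classes, at most `m * (n + 1).choose j`; summing over `j`
gives the constant `2 ^ (n + 1)`. -/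

section

/-! ### Homological algebra: additivity of the Euler characteristic -/

open CategoryTheory

/-- The complex `C` has finite-dimensional total homology, of Euler characteristic `e`. -/
def HasEuler (C : ChainComplex (ModuleCat.{0} ℚ) ℕ) (e : ℤ) : Prop :=
  (∀ n, FiniteDimensional ℚ (C.homology n)) ∧ (∃ N, ∀ n ≥ N, Subsingleton (C.homology n)) ∧
    C.homologyEulerChar = e

theorem homologyEulerChar_eq_sum_range {C : ChainComplex (ModuleCat.{0} ℚ) ℕ} {N : ℕ}
    (h : ∀ n ≥ N, Subsingleton (C.homology n)) :
    C.homologyEulerChar =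
      ∑ n ∈ Finset.range N, (-1 : ℤ) ^ n * Module.finrank ℚ (C.homology n) := by
  rw [HomologicalComplex.homologyEulerChar_eq_sum_finSet_of_finrankSupport_subset C
    (Finset.range N)]
  · simp [ComplexShape.χ, ComplexShape.EulerCharSigns.χ]
  · rw [GradedObject.finrankSupport_subset_iff]
    intro n hn
    have := h n (by simpa using hn)
    exact Module.finrank_zero_of_subsingleton

theorem HasEuler.of_homology_equiv {C D : ChainComplex (ModuleCat.{0} ℚ) ℕ} {e : ℤ}
    (i : ∀ n, Nonempty (C.homology n ≃ₗ[ℚ] D.homology n)) (h : HasEuler C e) : HasEuler D e := by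
  obtain ⟨h1, ⟨N, h2⟩, h3⟩ := h
  have h2' : ∀ n ≥ N, Subsingleton (D.homology n) := fun n hn =>
    have := h2 n hn
    (i n).some.symm.toEquiv.subsingleton
  refine ⟨fun n => (i n).some.finiteDimensional, ⟨N, h2'⟩, ?_⟩
  rw [← h3, homologyEulerChar_eq_sum_range h2, homologyEulerChar_eq_sum_range h2']
  exact Finset.sum_congr rfl fun n _ => by rw [(i n).some.finrank_eq]

theorem HasEuler.of_iso {C D : ChainComplex (ModuleCat.{0} ℚ) ℕ} {e : ℤ}
    (i : C ≅ D) (h : HasEuler C e) : HasEuler D e :=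
  h.of_homology_equiv fun n =>
    ⟨((HomologicalComplex.homologyFunctor _ _ n).mapIso i).toLinearEquiv⟩

theorem HasEuler.of_exactAt {C : ChainComplex (ModuleCat.{0} ℚ) ℕ} (h : ∀ n, C.ExactAt n) :
    HasEuler C 0 := by
  have h' : ∀ n, Subsingleton (C.homology n) := fun n =>
    ModuleCat.subsingleton_of_isZero (h n).isZero_homology
  refine ⟨fun n => have := h' n; inferInstance, ⟨0, fun n _ => h' n⟩, ?_⟩
  rw [homologyEulerChar_eq_sum_range (N := 0) fun n _ => h' n]
  simp

theorem HasEuler.unique {C : ChainComplex (ModuleCat.{0} ℚ) ℕ} {a b : ℤ} (ha : HasEuler C a)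
    (hb : HasEuler C b) : a = b := ha.2.2.symm.trans hb.2.2

section LinearAlgebra

variable {K A B C : Type*} [Field K] [AddCommGroup A] [Module K A] [AddCommGroup B] [Module K B]
  [AddCommGroup C] [Module K C]

theorem FiniteDimensional.of_exact {f : A →ₗ[K] B} {g : B →ₗ[K] C} (h : Function.Exact f g)
    [FiniteDimensional K A] [FiniteDimensional K C] : FiniteDimensional K B := by
  have e : LinearMap.ker g = LinearMap.range f := LinearMap.exact_iff.mp h
  have h1 : (LinearMap.ker g).FG := by
    rw [e]
    exact Module.Finite.iff_fg.mp inferInstance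
  refine ⟨Submodule.fg_of_fg_map_of_fg_inf_ker g ?_ (by simpa using h1)⟩
  exact IsNoetherian.noetherian _

theorem finrank_eq_finrank_range_add_finrank_range {f : A →ₗ[K] B} {g : B →ₗ[K] C}
    (h : Function.Exact f g) [FiniteDimensional K B] :
    Module.finrank K B =
      Module.finrank K (LinearMap.range f) + Module.finrank K (LinearMap.range g) := by
  rw [← LinearMap.exact_iff.mp h, add_comm, LinearMap.finrank_range_add_finrank_ker]

/-- The alternating sum of dimensions in a long exact sequence that ends with `C 0`. -/
theorem sum_finrank_of_exact {A B C : ℕ → Type*} [∀ n, AddCommGroup (A n)] [∀ n, Module K (A n)]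
    [∀ n, AddCommGroup (B n)] [∀ n, Module K (B n)] [∀ n, AddCommGroup (C n)] [∀ n, Module K (C n)]
    [∀ n, FiniteDimensional K (A n)] [∀ n, FiniteDimensional K (B n)]
    [∀ n, FiniteDimensional K (C n)]
    (f : ∀ n, A n →ₗ[K] B n) (g : ∀ n, B n →ₗ[K] C n) (δ : ∀ n, C (n + 1) →ₗ[K] A n)
    (h1 : ∀ n, Function.Exact (δ n) (f n)) (h2 : ∀ n, Function.Exact (f n) (g n))
    (h3 : ∀ n, Function.Exact (g (n + 1)) (δ n)) (h0 : Function.Surjective (g 0)) (N : ℕ) :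
    ∑ n ∈ Finset.range (N + 1), (-1 : ℤ) ^ n * Module.finrank K (B n) =
      ∑ n ∈ Finset.range (N + 1), (-1 : ℤ) ^ n * Module.finrank K (A n) +
      ∑ n ∈ Finset.range (N + 1), (-1 : ℤ) ^ n * Module.finrank K (C n) -
        (-1) ^ N * Module.finrank K (LinearMap.range (δ N)) := by
  -- The sequence cut off at degree `N` fails to be exact only at its left end, which accounts for
  -- the rank of `δ N`.
  induction N with
  | zero =>
    have e1 := finrank_eq_finrank_range_add_finrank_range (h1 0)
    have e2 := finrank_eq_finrank_range_add_finrank_range (h2 0)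
    rw [LinearMap.range_eq_top.mpr h0, finrank_top] at e2
    simp
    omega
  | succ N ih =>
    rw [Finset.sum_range_succ, Finset.sum_range_succ _ (N + 1), Finset.sum_range_succ _ (N + 1), ih,
      finrank_eq_finrank_range_add_finrank_range (h1 (N + 1)),
      finrank_eq_finrank_range_add_finrank_range (h2 (N + 1)),
      finrank_eq_finrank_range_add_finrank_range (h3 N)]
    push_cast
    ring

end LinearAlgebra

section ShortExact

variable {S : ShortComplex (ChainComplex (ModuleCat.{0} ℚ) ℕ)} (hS : S.ShortExact)

include hS

theorem exact_homologyMap (n : ℕ) :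
    Function.Exact (HomologicalComplex.homologyMap S.f n).hom
      (HomologicalComplex.homologyMap S.g n).hom :=
  (ShortComplex.ShortExact.moduleCat_exact_iff_function_exact _).mp (hS.homology_exact₂ n)

theorem exact_homologyMap_δ (n : ℕ) :
    Function.Exact (HomologicalComplex.homologyMap S.g (n + 1)).hom (hS.δ (n + 1) n rfl).hom :=
  (ShortComplex.ShortExact.moduleCat_exact_iff_function_exact _).mp
    (hS.homology_exact₃ (n + 1) n rfl)

theorem exact_δ_homologyMap (n : ℕ) :
    Function.Exact (hS.δ (n + 1) n rfl).hom (HomologicalComplex.homologyMap S.f n).hom :=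
  (ShortComplex.ShortExact.moduleCat_exact_iff_function_exact _).mp
    (hS.homology_exact₁ (n + 1) n rfl)

theorem surjective_homologyMap_zero :
    Function.Surjective (HomologicalComplex.homologyMap S.g 0).hom := by
  have := hS.epi_g
  have : Epi (HomologicalComplex.homologyMap S.g 0) :=
    HomologicalComplex.epi_homologyMap_of_epi_of_not_rel S.g 0 (by simp)
  exact (ModuleCat.epi_iff_surjective _).mp this

theorem homologyEulerChar_of_shortExact {N₁ N₂ N₃ : ℕ}
    [∀ n, FiniteDimensional ℚ (S.X₁.homology n)] [∀ n, FiniteDimensional ℚ (S.X₂.homology n)]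
    [∀ n, FiniteDimensional ℚ (S.X₃.homology n)]
    (h1 : ∀ n ≥ N₁, Subsingleton (S.X₁.homology n)) (h2 : ∀ n ≥ N₂, Subsingleton (S.X₂.homology n))
    (h3 : ∀ n ≥ N₃, Subsingleton (S.X₃.homology n)) :
    S.X₂.homologyEulerChar = S.X₁.homologyEulerChar + S.X₃.homologyEulerChar := by
  -- Beyond all three bounds the target of `δ N` vanishes, and the correction term with it.
  set N := max N₁ (max N₂ N₃) with hN
  rw [homologyEulerChar_eq_sum_range (N := N + 1) fun n hn => h1 n (by omega),
    homologyEulerChar_eq_sum_range (N := N + 1) fun n hn => h2 n (by omega),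
    homologyEulerChar_eq_sum_range (N := N + 1) fun n hn => h3 n (by omega),
    sum_finrank_of_exact (K := ℚ) _ _ _ (exact_δ_homologyMap hS) (exact_homologyMap hS)
      (exact_homologyMap_δ hS) (surjective_homologyMap_zero hS) N]
  have := h1 N (by omega)
  have : LinearMap.range (hS.δ (N + 1) N rfl).hom = ⊥ := Subsingleton.elim _ _
  rw [this]
  simp

theorem HasEuler.middle {a c : ℤ} (ha : HasEuler S.X₁ a) (hc : HasEuler S.X₃ c) :
    HasEuler S.X₂ (a + c) := by
  obtain ⟨f1, ⟨N₁, n1⟩, rfl⟩ := ha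
  obtain ⟨f3, ⟨N₃, n3⟩, rfl⟩ := hc
  have f2 : ∀ n, FiniteDimensional ℚ (S.X₂.homology n) := fun n =>
    FiniteDimensional.of_exact (exact_homologyMap hS n)
  have n2 : ∀ n ≥ max N₁ N₃, Subsingleton (S.X₂.homology n) := fun n hn => by
    have := n1 n (by omega)
    have := n3 n (by omega)
    refine ⟨fun x y => ?_⟩
    obtain ⟨z, hz⟩ := (exact_homologyMap hS n (x - y)).mp (Subsingleton.elim _ _)
    rw [Subsingleton.elim z 0, map_zero] at hz
    exact sub_eq_zero.mp hz.symm
  exact ⟨f2, ⟨_, n2⟩, homologyEulerChar_of_shortExact hS n1 n2 n3⟩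

theorem HasEuler.right {a b : ℤ} (ha : HasEuler S.X₁ a) (hb : HasEuler S.X₂ b) :
    HasEuler S.X₃ (b - a) := by
  obtain ⟨f1, ⟨N₁, n1⟩, rfl⟩ := ha
  obtain ⟨f2, ⟨N₂, n2⟩, rfl⟩ := hb
  have f3 : ∀ n, FiniteDimensional ℚ (S.X₃.homology n) := fun n => by
    rcases n with _ | n
    · exact Module.Finite.of_surjective _ (surjective_homologyMap_zero hS)
    · exact FiniteDimensional.of_exact (exact_homologyMap_δ hS n)
  -- The bound rises by one because the homology of `X₃` in degree `n + 1` lies between that of `X₂`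
  -- in degree `n + 1` and that of `X₁` in degree `n`.
  have n3 : ∀ n ≥ max N₁ N₂ + 1, Subsingleton (S.X₃.homology n) := fun n hn => by
    rcases n with _ | n
    · omega
    have := n1 n (by omega)
    have := n2 (n + 1) (by omega)
    refine ⟨fun x y => ?_⟩
    obtain ⟨z, hz⟩ := (exact_homologyMap_δ hS n (x - y)).mp (Subsingleton.elim _ _)
    rw [Subsingleton.elim z 0, map_zero] at hz
    exact sub_eq_zero.mp hz.symm
  refine ⟨f3, ⟨_, n3⟩, ?_⟩
  rw [homologyEulerChar_of_shortExact hS n1 n2 n3]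
  ring

end ShortExact

/-! ### Complexes and short exact sequences given degreewise -/

section Elementwise

/-- The chain complex given by a sequence of vector spaces and differentials. -/
noncomputable def linComplex (M : ℕ → Type) [∀ n, AddCommGroup (M n)] [∀ n, Module ℚ (M n)]
    (d : ∀ n, M (n + 1) →ₗ[ℚ] M n) (h : ∀ n, d n ∘ₗ d (n + 1) = 0) :
    ChainComplex (ModuleCat.{0} ℚ) ℕ :=
  ChainComplex.of (fun n => ModuleCat.of ℚ (M n)) (fun n => ModuleCat.ofHom (d n))
    fun n => by rw [← ModuleCat.ofHom_comp, h]; rfl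

variable {M₁ M₂ M₃ : ℕ → Type} [∀ n, AddCommGroup (M₁ n)] [∀ n, Module ℚ (M₁ n)]
  [∀ n, AddCommGroup (M₂ n)] [∀ n, Module ℚ (M₂ n)] [∀ n, AddCommGroup (M₃ n)]
  [∀ n, Module ℚ (M₃ n)]
  {d₁ : ∀ n, M₁ (n + 1) →ₗ[ℚ] M₁ n} {h₁ : ∀ n, d₁ n ∘ₗ d₁ (n + 1) = 0}
  {d₂ : ∀ n, M₂ (n + 1) →ₗ[ℚ] M₂ n} {h₂ : ∀ n, d₂ n ∘ₗ d₂ (n + 1) = 0}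
  {d₃ : ∀ n, M₃ (n + 1) →ₗ[ℚ] M₃ n} {h₃ : ∀ n, d₃ n ∘ₗ d₃ (n + 1) = 0}

theorem linComplex_d (n : ℕ) : (linComplex M₁ d₁ h₁).d (n + 1) n = ModuleCat.ofHom (d₁ n) :=
  ChainComplex.of_d (fun n => ModuleCat.of ℚ (M₁ n)) (fun n => ModuleCat.ofHom (d₁ n)) n

/-- A chain map given degreewise. -/
noncomputable def linComplexHom (f : ∀ n, M₁ n →ₗ[ℚ] M₂ n)
    (hf : ∀ n x, d₂ n (f (n + 1) x) = f n (d₁ n x)) :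
    linComplex M₁ d₁ h₁ ⟶ linComplex M₂ d₂ h₂ :=
  ChainComplex.ofHom (fun n => ModuleCat.ofHom (f n)) fun n => by
    rw [linComplex_d, linComplex_d]
    ext x
    exact hf n x

/-- An isomorphism of complexes given degreewise. -/
noncomputable def linComplexIso (f : ∀ n, M₁ n ≃ₗ[ℚ] M₂ n)
    (hf : ∀ n x, d₂ n (f (n + 1) x) = f n (d₁ n x)) :
    linComplex M₁ d₁ h₁ ≅ linComplex M₂ d₂ h₂ :=
  HomologicalComplex.Hom.isoOfComponents (fun n => (f n).toModuleIso) fun i j hij => by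
    obtain rfl : j + 1 = i := hij
    rw [linComplex_d, linComplex_d]
    ext x
    exact hf j x

variable (f : ∀ n, M₁ n →ₗ[ℚ] M₂ n) (hf : ∀ n x, d₂ n (f (n + 1) x) = f n (d₁ n x))
  (g : ∀ n, M₂ n →ₗ[ℚ] M₃ n) (hg : ∀ n x, d₃ n (g (n + 1) x) = g n (d₂ n x))
  (hfi : ∀ n, Function.Injective (f n)) (hgs : ∀ n, Function.Surjective (g n))
  (hfg : ∀ n, Function.Exact (f n) (g n))

include hf hg hfi hgs hfg

/-- The terms are given through equations so that the abstract results on short exact sequences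
transfer by rewriting. -/
theorem exists_shortExact_linComplex :
    ∃ S : ShortComplex (ChainComplex (ModuleCat.{0} ℚ) ℕ), S.ShortExact ∧
      S.X₁ = linComplex M₁ d₁ h₁ ∧ S.X₂ = linComplex M₂ d₂ h₂ ∧ S.X₃ = linComplex M₃ d₃ h₃ := by
  refine ⟨ShortComplex.mk (linComplexHom (h₁ := h₁) (h₂ := h₂) f hf)
    (linComplexHom (h₂ := h₃) g hg) ?_, ?_, rfl, rfl, rfl⟩
  · ext n x
    exact (hfg n (f n x)).mpr ⟨x, rfl⟩
  · refine HomologicalComplex.shortExact_of_degreewise_shortExact _ fun n => ?_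
    refine @ShortComplex.ShortExact.mk _ _ _ _ ?_ ?_ ?_
    · exact (ShortComplex.ShortExact.moduleCat_exact_iff_function_exact _).mpr (hfg n)
    · exact (ModuleCat.mono_iff_injective _).mpr (hfi n)
    · exact (ModuleCat.epi_iff_surjective _).mpr (hgs n)

theorem HasEuler.linComplex_middle {a c : ℤ} (ha : HasEuler (linComplex M₁ d₁ h₁) a)
    (hc : HasEuler (linComplex M₃ d₃ h₃) c) : HasEuler (linComplex M₂ d₂ h₂) (a + c) := by
  obtain ⟨S, hS, e1, e2, e3⟩ := exists_shortExact_linComplex (h₁ := h₁) (h₂ := h₂) (h₃ := h₃)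
    f hf g hg hfi hgs hfg
  rw [← e1] at ha
  rw [← e3] at hc
  rw [← e2]
  exact ha.middle hS hc

theorem HasEuler.linComplex_right {a b : ℤ} (ha : HasEuler (linComplex M₁ d₁ h₁) a)
    (hb : HasEuler (linComplex M₂ d₂ h₂) b) : HasEuler (linComplex M₃ d₃ h₃) (b - a) := by
  obtain ⟨S, hS, e1, e2, e3⟩ := exists_shortExact_linComplex (h₁ := h₁) (h₂ := h₂) (h₃ := h₃)
    f hf g hg hfi hgs hfg
  rw [← e1] at ha
  rw [← e2] at hb
  rw [← e3]
  exact ha.right hS hb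

omit hf hg hfi hgs hfg in
theorem HasEuler.linComplex_of_exact (h0 : ∀ x : M₁ 0, ∃ y, d₁ 0 y = x)
    (hs : ∀ n (x : M₁ (n + 1)), d₁ n x = 0 → ∃ y, d₁ (n + 1) y = x) :
    HasEuler (linComplex M₁ d₁ h₁) 0 := by
  refine HasEuler.of_exactAt fun n => ?_
  rcases n with _ | n
  · rw [HomologicalComplex.exactAt_iff' _ 1 0 0 (by simp) (by simp),
      ShortComplex.moduleCat_exact_iff]
    intro x _
    obtain ⟨y, hy⟩ := h0 x
    refine ⟨y, ?_⟩
    have := linComplex_d (h₁ := h₁) 0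
    exact (congrArg (fun f => f.hom y) this).trans hy
  · rw [HomologicalComplex.exactAt_iff' _ (n + 2) (n + 1) n (by simp) (by simp),
      ShortComplex.moduleCat_exact_iff]
    intro x hx
    obtain ⟨y, hy⟩ := hs n x <| by
      have := linComplex_d (h₁ := h₁) n
      exact (congrArg (fun f => f.hom x) this).symm.trans hx
    refine ⟨y, ?_⟩
    have := linComplex_d (h₁ := h₁) (n + 1)
    exact (congrArg (fun f => f.hom y) this).trans hy

end Elementwise

end

/-! ### Chains on tuples -/

/-- Formal linear combinations of `k`-tuples of points. -/
abbrev TupleChain (V : Type) (k : ℕ) : Type := (Fin k → V) →₀ ℚ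

namespace TupleChain

variable {V W : Type}

/-- The boundary operator of the (augmented) complex of tuples. -/
noncomputable def boundary (k : ℕ) : TupleChain V (k + 1) →ₗ[ℚ] TupleChain V k :=
  Finsupp.linearCombination ℚ fun v =>
    ∑ i : Fin (k + 1), (-1 : ℚ) ^ (i : ℕ) • Finsupp.single (v ∘ i.succAbove) 1

/-- The cone with apex `b`. -/
noncomputable def cone (b : V) (k : ℕ) : TupleChain V k →ₗ[ℚ] TupleChain V (k + 1) :=
  Finsupp.lmapDomain ℚ ℚ (fun v => (Fin.cons b v : Fin (k + 1) → V))

/-- The map of chains induced by a map of points. -/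
noncomputable def map (f : V → W) (k : ℕ) : TupleChain V k →ₗ[ℚ] TupleChain W k :=
  Finsupp.lmapDomain ℚ ℚ (fun v => f ∘ v)

theorem boundary_single {k : ℕ} (v : Fin (k + 1) → V) :
    boundary k (Finsupp.single v 1) =
      ∑ i : Fin (k + 1), (-1 : ℚ) ^ (i : ℕ) • Finsupp.single (v ∘ i.succAbove) 1 := by
  simp [boundary]

theorem cone_single (b : V) {k : ℕ} (v : Fin k → V) (c : ℚ) :
    cone b k (Finsupp.single v c) = Finsupp.single (Fin.cons b v : Fin (k + 1) → V) c := by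
  simp [cone]

theorem map_single (f : V → W) {k : ℕ} (v : Fin k → V) (c : ℚ) :
    map f k (Finsupp.single v c) = Finsupp.single (f ∘ v) c := by
  simp [map]

theorem boundary_cone_zero (b : V) (c : TupleChain V 0) : boundary 0 (cone b 0 c) = c := by
  induction c using Finsupp.induction_linear with
  | zero => simp
  | add x y hx hy => simp [hx, hy]
  | single v q =>
    rw [← mul_one q, ← smul_eq_mul, ← Finsupp.smul_single, map_smul, map_smul, cone_single,
      boundary_single]
    congr 1
    simp

/-- Omitting the apex returns the tuple; omitting any other point gives a cone over a face, with the
index shifted by one and hence the opposite sign. So the cone is a contracting homotopy of the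
augmented complex. -/
theorem boundary_cone (b : V) {k : ℕ} (c : TupleChain V (k + 1)) :
    boundary (k + 1) (cone b (k + 1) c) = c - cone b k (boundary k c) := by
  induction c using Finsupp.induction_linear with
  | zero => simp
  | add x y hx hy => simp only [map_add, hx, hy]; abel
  | single v q =>
    rw [← mul_one q, ← smul_eq_mul, ← Finsupp.smul_single]
    simp only [map_smul, cone_single, boundary_single]
    rw [← smul_sub]
    congr 1
    rw [Fin.sum_univ_succ, map_sum, sub_eq_add_neg, ← Finset.sum_neg_distrib]
    congr 1
    · simp only [Fin.val_zero, pow_zero, one_smul]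
      congr 1
    · refine Finset.sum_congr rfl fun i _ => ?_
      rw [map_smul, cone_single, Fin.val_succ, pow_succ, mul_neg_one, neg_smul]
      congr 3
      ext j
      refine Fin.cases ?_ (fun j => ?_) j <;> simp

/-- Every tuple is the cone from its first point over the rest, so the cone formula lowers the
degree. -/
theorem boundary_boundary {k : ℕ} (c : TupleChain V (k + 2)) :
    boundary k (boundary (k + 1) c) = 0 := by
  induction k using Nat.strong_induction_on with | _ k ih =>
  induction c using Finsupp.induction_linear with
  | zero => simp
  | add x y hx hy => simp only [map_add, hx, hy, add_zero]
  | single v q =>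
    have hv : Finsupp.single v q = cone (v 0) (k + 1) (Finsupp.single (Fin.tail v) q) := by
      rw [cone_single, Fin.cons_self_tail]
    rw [hv, boundary_cone, map_sub]
    rcases k with _ | k
    · rw [boundary_cone_zero, sub_self]
    · rw [boundary_cone, ih k (by omega), map_zero, sub_zero, sub_self]

theorem boundary_map (f : V → W) {k : ℕ} (c : TupleChain V (k + 1)) :
    boundary k (map f (k + 1) c) = map f k (boundary k c) := by
  induction c using Finsupp.induction_linear with
  | zero => simp
  | add x y hx hy => simp only [map_add, hx, hy]
  | single v q =>
    rw [← mul_one q, ← smul_eq_mul, ← Finsupp.smul_single]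
    simp only [map_smul, map_single, boundary_single, map_sum]
    rfl

theorem map_cone (f : V → W) (b : V) {k : ℕ} (c : TupleChain V k) :
    map f (k + 1) (cone b k c) = cone (f b) k (map f k c) := by
  induction c using Finsupp.induction_linear with
  | zero => simp
  | add x y hx hy => simp only [map_add, hx, hy]
  | single v q =>
    simp only [map_single, cone_single]
    congr 1
    ext j
    refine Fin.cases ?_ (fun j => ?_) j <;> simp

/-! ### Subdivision of tuples by iterated cones -/

section Subdivision

variable (β : ∀ k, (Fin (k + 1) → V) → V)

/-- The subdivision operator with the cone points `β`. -/
noncomputable def subdiv : ∀ k, TupleChain V k →ₗ[ℚ] TupleChain V k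
  | 0 => LinearMap.id
  | k + 1 => Finsupp.linearCombination ℚ fun v =>
      cone (β k v) k (subdiv k (boundary k (Finsupp.single v 1)))

/-- The chain homotopy between the identity and the subdivision operator. -/
noncomputable def subdivHomotopy : ∀ k, TupleChain V k →ₗ[ℚ] TupleChain V (k + 1)
  | 0 => 0
  | k + 1 => Finsupp.linearCombination ℚ fun v =>
      cone (β k v) (k + 1)
        (Finsupp.single v 1 - subdivHomotopy k (boundary k (Finsupp.single v 1)))

theorem subdiv_single {k : ℕ} (v : Fin (k + 1) → V) :
    subdiv β (k + 1) (Finsupp.single v 1) =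
      cone (β k v) k (subdiv β k (boundary k (Finsupp.single v 1))) := by
  simp [subdiv]

theorem subdivHomotopy_single {k : ℕ} (v : Fin (k + 1) → V) :
    subdivHomotopy β (k + 1) (Finsupp.single v 1) = cone (β k v) (k + 1)
        (Finsupp.single v 1 - subdivHomotopy β k (boundary k (Finsupp.single v 1))) := by
  simp [subdivHomotopy]

/-- By induction the subdivided boundary of a tuple is a cycle, and the cone over a cycle has it as
boundary. -/
theorem boundary_subdiv {k : ℕ} (c : TupleChain V (k + 1)) :
    boundary k (subdiv β (k + 1) c) = subdiv β k (boundary k c) := by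
  induction k using Nat.strong_induction_on with | _ k ih =>
  induction c using Finsupp.induction_linear with
  | zero => simp
  | add x y hx hy => simp only [map_add, hx, hy]
  | single v q =>
    rw [← mul_one q, ← smul_eq_mul, ← Finsupp.smul_single]
    simp only [map_smul]
    congr 1
    rw [subdiv_single]
    rcases k with _ | k
    · rw [boundary_cone_zero]
    · rw [boundary_cone, ih k (by omega), boundary_boundary, map_zero, map_zero, sub_zero]

theorem boundary_subdivHomotopy_zero (c : TupleChain V 0) :
    boundary 0 (subdivHomotopy β 0 c) = c - subdiv β 0 c := by
  simp [subdivHomotopy, subdiv]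

/-- Write `H` for the homotopy. By induction the boundary of `v - H (∂ v)` is the subdivision of `∂
v`, whose cone is the subdivision of `v`; the cone formula then gives the claim. -/
theorem boundary_subdivHomotopy {k : ℕ} (c : TupleChain V (k + 1)) :
    boundary (k + 1) (subdivHomotopy β (k + 1) c) =
      c - subdiv β (k + 1) c - subdivHomotopy β k (boundary k c) := by
  induction k using Nat.strong_induction_on with | _ k ih =>
  induction c using Finsupp.induction_linear with
  | zero => simp
  | add x y hx hy => simp only [map_add, hx, hy]; abel
  | single v q =>
    rw [← mul_one q, ← smul_eq_mul, ← Finsupp.smul_single]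
    simp only [map_smul]
    rw [← smul_sub, ← smul_sub]
    congr 1
    rw [subdivHomotopy_single, boundary_cone, map_sub, subdiv_single]
    have : boundary k (subdivHomotopy β k (boundary k (Finsupp.single v 1))) =
        boundary k (Finsupp.single v 1) - subdiv β k (boundary k (Finsupp.single v 1)) := by
      rcases k with _ | k
      · rw [boundary_subdivHomotopy_zero]
      · rw [ih k (by omega), boundary_boundary, map_zero, sub_zero]
    rw [this, sub_sub_cancel]
    abel

variable {β} {β' : ∀ k, (Fin (k + 1) → W) → W} {f : V → W}
  (hf : ∀ k v, f (β k v) = β' k (f ∘ v))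

include hf

/-- Naturality holds because `f` respects the cone points. For affine maps and barycenters this
permits defining the subdivision of a singular simplex on the standard simplex. -/
theorem map_subdiv {k : ℕ} (c : TupleChain V k) :
    map f k (subdiv β k c) = subdiv β' k (map f k c) := by
  induction k using Nat.strong_induction_on with | _ k ih =>
  induction c using Finsupp.induction_linear with
  | zero => simp
  | add x y hx hy => simp only [map_add, hx, hy]
  | single v q =>
    rcases k with _ | k
    · rfl
    rw [← mul_one q, ← smul_eq_mul, ← Finsupp.smul_single]
    simp only [map_smul]
    congr 1
    rw [subdiv_single, map_cone, ih k (by omega), map_single, subdiv_single, ← boundary_map, hf,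
      map_single]

theorem map_subdivHomotopy {k : ℕ} (c : TupleChain V k) :
    map f (k + 1) (subdivHomotopy β k c) = subdivHomotopy β' k (map f k c) := by
  induction k using Nat.strong_induction_on with | _ k ih =>
  induction c using Finsupp.induction_linear with
  | zero => simp
  | add x y hx hy => simp only [map_add, hx, hy]
  | single v q =>
    rcases k with _ | k
    · simp [subdivHomotopy]
    rw [← mul_one q, ← smul_eq_mul, ← Finsupp.smul_single]
    simp only [map_smul]
    congr 1
    rw [subdivHomotopy_single, map_cone, map_sub, ih k (by omega), map_single,
      subdivHomotopy_single, ← boundary_map, hf, map_single]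

end Subdivision

end TupleChain

/-! ### Subcomplexes -/

section Subcomplex

variable {K : ℕ → Type} [∀ n, AddCommGroup (K n)] [∀ n, Module ℚ (K n)]
  {d : ∀ n, K (n + 1) →ₗ[ℚ] K n} (hd : ∀ n, d n ∘ₗ d (n + 1) = 0)
  {P Q R : ∀ n, Submodule ℚ (K n)}

/-- The subcomplex given by a sequence of subspaces that are preserved by the differential. -/
noncomputable def subComplex (hP : ∀ n, ∀ x ∈ P (n + 1), d n x ∈ P n) :
    ChainComplex (ModuleCat.{0} ℚ) ℕ :=
  linComplex (fun n => P n) (fun n => (d n).restrict (hP n)) fun n => by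
    ext x
    exact LinearMap.congr_fun (hd n) (x : K (n + 2))

variable {hP : ∀ n, ∀ x ∈ P (n + 1), d n x ∈ P n} {hQ : ∀ n, ∀ x ∈ Q (n + 1), d n x ∈ Q n}
  {hR : ∀ n, ∀ x ∈ R (n + 1), d n x ∈ R n}

theorem HasEuler.subComplex_congr {a : ℤ} (h : P = Q) (ha : HasEuler (subComplex hd hP) a) :
    HasEuler (subComplex hd hQ) a := by
  subst h
  exact ha

theorem HasEuler.prod {a b : ℤ} (ha : HasEuler (subComplex hd hP) a)
    (hb : HasEuler (subComplex hd hQ) b) :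
    HasEuler (linComplex (fun n => P n × Q n)
      (fun n => ((d n).restrict (hP n)).prodMap ((d n).restrict (hQ n))) fun n => by
        ext x
        · exact LinearMap.congr_fun (hd n) (x : K (n + 2))
        · simp
        · simp
        · exact LinearMap.congr_fun (hd n) (x : K (n + 2))) (a + b) :=
  HasEuler.linComplex_middle (fun n => LinearMap.inl ℚ (P n) (Q n)) (fun n x => by simp)
    (fun n => LinearMap.snd ℚ (P n) (Q n)) (fun n x => by simp)
    (fun n => LinearMap.inl_injective) (fun n => LinearMap.snd_surjective)
    (fun n => Function.Exact.inl_snd) ha hb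

/-- The Mayer-Vietoris property of the Euler characteristic, for subcomplexes. -/
theorem HasEuler.sup {hI : ∀ n, ∀ x ∈ P (n + 1) ⊓ Q (n + 1), d n x ∈ P n ⊓ Q n}
    {hS : ∀ n, ∀ x ∈ P (n + 1) ⊔ Q (n + 1), d n x ∈ P n ⊔ Q n}
    {a b c : ℤ} (ha : HasEuler (subComplex hd hP) a)
    (hb : HasEuler (subComplex hd hQ) b)
    (hc : HasEuler (subComplex (P := fun n => P n ⊓ Q n) hd hI) c) :
    HasEuler (subComplex (P := fun n => P n ⊔ Q n) hd hS) (a + b - c) := by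
  refine HasEuler.linComplex_right
    -- The sequence is `0 → P ⊓ Q → P × Q → P ⊔ Q → 0` with the maps `x ↦ (x, -x)` and addition.
    (f := fun n => (Submodule.inclusion inf_le_left).prod (-Submodule.inclusion inf_le_right)) ?_
    (g := fun n => (Submodule.inclusion le_sup_left).coprod (Submodule.inclusion le_sup_right))
    ?_ ?_ ?_ ?_ hc (ha.prod hd hb)
  · intro n x
    ext <;> simp
  · rintro n ⟨x, y⟩
    ext
    simp
  · intro n x y hxy
    ext
    simpa using congrArg (fun z => (z.1 : K n)) hxy
  · rintro n ⟨x, hx⟩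
    obtain ⟨y, hy, z, hz, rfl⟩ := Submodule.mem_sup.mp hx
    exact ⟨(⟨y, hy⟩, ⟨z, hz⟩), rfl⟩
  · rintro n ⟨⟨x, hx⟩, ⟨y, hy⟩⟩
    constructor
    · intro h
      have h' : x + y = 0 := congrArg Subtype.val h
      have hxy : y = -x := (neg_eq_of_add_eq_zero_right h').symm
      refine ⟨⟨x, hx, ?_⟩, ?_⟩
      · rw [← neg_neg x, ← hxy]
        exact neg_mem hy
      · ext
        · rfl
        · exact hxy.symm
    · rintro ⟨⟨z, hz⟩, h⟩
      have h1 : z = x := congrArg (fun z => (z.1 : K n)) h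
      have h2 : -z = y := congrArg (fun z => (z.2 : K n)) h
      ext
      change x + y = 0
      rw [← h1, ← h2, add_neg_cancel]

/-- A subcomplex has the same Euler characteristic if every relative cycle is, modulo the
subcomplex, a boundary. -/
theorem HasEuler.of_relative_exact (hPR : ∀ n, P n ≤ R n)
    (h0 : ∀ z ∈ R 0, ∃ w ∈ R 1, z - d 0 w ∈ P 0)
    (hs : ∀ n, ∀ z ∈ R (n + 1), d n z ∈ P n → ∃ w ∈ R (n + 2), z - d (n + 1) w ∈ P (n + 1))
    {a : ℤ} (ha : HasEuler (subComplex hd hP) a) : HasEuler (subComplex hd hR) a := by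
  -- `U` is `P` as a subcomplex of `R`. The hypotheses say that the quotient `R / U` is acyclic, so
  -- it contributes `0`.
  let U : ∀ n, Submodule ℚ (R n) := fun n => (P n).comap (R n).subtype
  have hU : ∀ n, U (n + 1) ≤ (U n).comap ((d n).restrict (hR n)) := fun n x hx => hP n _ hx
  have hdU : ∀ n, (U (n + 1)).mapQ (U n) ((d n).restrict (hR n)) (hU n) ∘ₗ
      (U (n + 2)).mapQ (U (n + 1)) ((d (n + 1)).restrict (hR (n + 1))) (hU (n + 1)) = 0 := by
    intro n
    ext x
    change (U n).mkQ _ = 0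
    rw [Submodule.mkQ_apply, Submodule.Quotient.mk_eq_zero]
    have : d n (d (n + 1) x) = 0 := LinearMap.congr_fun (hd n) (x : K (n + 2))
    change d n (d (n + 1) x) ∈ P n
    rw [this]
    exact zero_mem _
  have hq : HasEuler (linComplex (fun n => R n ⧸ U n) _ hdU) 0 := by
    refine HasEuler.linComplex_of_exact ?_ ?_
    · intro x
      obtain ⟨⟨z, hz⟩, rfl⟩ := (U 0).mkQ_surjective x
      obtain ⟨w, hw, h⟩ := h0 z hz
      refine ⟨(U 1).mkQ ⟨w, hw⟩, ?_⟩
      refine (Submodule.Quotient.eq' (U 0)).mpr ?_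
      change -(d 0 w) + z ∈ P 0
      rwa [neg_add_eq_sub]
    · intro n x hx
      obtain ⟨⟨z, hz⟩, rfl⟩ := (U (n + 1)).mkQ_surjective x
      have hz' : d n z ∈ P n := (Submodule.Quotient.mk_eq_zero (U n)).mp hx
      obtain ⟨w, hw, h⟩ := hs n z hz hz'
      refine ⟨(U (n + 2)).mkQ ⟨w, hw⟩, ?_⟩
      refine (Submodule.Quotient.eq' (U (n + 1))).mpr ?_
      change -(d (n + 1) w) + z ∈ P (n + 1)
      rwa [neg_add_eq_sub]
  have := HasEuler.linComplex_middle (h₂ := fun n => by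
      ext x
      exact LinearMap.congr_fun (hd n) (x : K (n + 2)))
    (f := fun n => Submodule.inclusion (hPR n)) (d₂ := fun n => (d n).restrict (hR n))
    (fun n x => rfl) (g := fun n => (U n).mkQ) (fun n x => rfl)
    (fun n => Submodule.inclusion_injective _) (fun n => (U n).mkQ_surjective) ?_ ha hq
  · rwa [add_zero] at this
  · intro n x
    rw [Submodule.mkQ_apply, Submodule.Quotient.mk_eq_zero]
    exact ⟨fun h => ⟨⟨x, h⟩, rfl⟩, by rintro ⟨y, rfl⟩; exact y.2⟩

end Subcomplex

/-! ### Singular chains and their subdivision -/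

/-- The affine map between standard simplices with given values on the vertices. -/
noncomputable def simplexAff {k m : ℕ} (v : Fin k → stdSimplex ℝ (Fin m)) :
    C(stdSimplex ℝ (Fin k), stdSimplex ℝ (Fin m)) where
  toFun t := ⟨fun l => ∑ i, t i * v i l,
    fun l => Finset.sum_nonneg fun i _ => mul_nonneg (t.2.1 i) ((v i).2.1 l), by
      rw [Finset.sum_comm]
      have : ∀ i, ∑ l, t i * v i l = t i := fun i => by
        rw [← Finset.mul_sum, stdSimplex.sum_eq_one, mul_one]
      simp [this]⟩
  continuous_toFun := by
    refine Continuous.subtype_mk (continuous_pi fun l => continuous_finsetSum _ fun i _ => ?_) _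
    exact ((continuous_apply i).comp continuous_subtype_val).mul continuous_const

theorem simplexAff_apply {k m : ℕ} (v : Fin k → stdSimplex ℝ (Fin m)) (t : stdSimplex ℝ (Fin k))
    (l : Fin m) : simplexAff v t l = ∑ i, t i * v i l := rfl

theorem simplexAff_simplexAff {j k m : ℕ} (v : Fin k → stdSimplex ℝ (Fin m))
    (w : Fin j → stdSimplex ℝ (Fin k)) (t : stdSimplex ℝ (Fin j)) :
    simplexAff v (simplexAff w t) = simplexAff (simplexAff v ∘ w) t := by
  ext l
  simp only [simplexAff_apply, Function.comp, Finset.sum_mul, Finset.mul_sum]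
  rw [Finset.sum_comm]
  exact Finset.sum_congr rfl fun i _ => Finset.sum_congr rfl fun i' _ => by ring

theorem simplexAff_vertex {k m : ℕ} (v : Fin k → stdSimplex ℝ (Fin m)) (i : Fin k) :
    simplexAff v (stdSimplex.vertex i) = v i := by
  ext l
  simp [simplexAff_apply, Pi.single_apply]

theorem simplexAff_vertex_eq_id (k : ℕ) :
    simplexAff (stdSimplex.vertex (S := ℝ) (X := Fin k)) = ContinuousMap.id _ := by
  ext t l
  simp [simplexAff_apply, Pi.single_apply]

/-- The barycenter of a tuple of points. -/
noncomputable def tupleBarycenter {m : ℕ} (k : ℕ) (v : Fin (k + 1) → stdSimplex ℝ (Fin m)) :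
    stdSimplex ℝ (Fin m) :=
  simplexAff v stdSimplex.barycenter

/-- This is the compatibility with cone points that naturality of the subdivision requires. -/
theorem simplexAff_tupleBarycenter {j m : ℕ} (v : Fin j → stdSimplex ℝ (Fin m)) (k : ℕ)
    (w : Fin (k + 1) → stdSimplex ℝ (Fin j)) :
    simplexAff v (tupleBarycenter k w) = tupleBarycenter k (simplexAff v ∘ w) :=
  simplexAff_simplexAff _ _ _

/-- Singular chains with rational coefficients. -/
abbrev SingChain (X : Type) [TopologicalSpace X] (n : ℕ) : Type :=
  C(stdSimplex ℝ (Fin (n + 1)), X) →₀ ℚ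

namespace SingChain

variable {X : Type} [TopologicalSpace X]

/-- The inclusion of a facet of the standard simplex. -/
noncomputable abbrev face {n : ℕ} (i : Fin (n + 2)) :
    C(stdSimplex ℝ (Fin (n + 1)), stdSimplex ℝ (Fin (n + 2))) :=
  simplexAff (stdSimplex.vertex ∘ i.succAbove)

/-- The singular boundary operator. -/
noncomputable def boundary (n : ℕ) : SingChain X (n + 1) →ₗ[ℚ] SingChain X n :=
  Finsupp.linearCombination ℚ fun σ =>
    ∑ i : Fin (n + 2), (-1 : ℚ) ^ (i : ℕ) • Finsupp.single (σ.comp (face i)) 1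

/-- The chain of affine singular simplices in the singular simplex `σ` that is given by a chain of
tuples. -/
noncomputable def push {m : ℕ} (σ : C(stdSimplex ℝ (Fin m), X)) (k : ℕ) :
    TupleChain (stdSimplex ℝ (Fin m)) (k + 1) →ₗ[ℚ] SingChain X k :=
  Finsupp.lmapDomain ℚ ℚ fun v => σ.comp (simplexAff v)

/-- The tuple of all vertices of the standard simplex, as a chain. -/
noncomputable def fundamental (k : ℕ) : TupleChain (stdSimplex ℝ (Fin k)) k :=
  Finsupp.single stdSimplex.vertex 1

theorem boundary_single {n : ℕ} (σ : C(stdSimplex ℝ (Fin (n + 2)), X)) :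
    boundary n (Finsupp.single σ 1) =
      ∑ i : Fin (n + 2), (-1 : ℚ) ^ (i : ℕ) • Finsupp.single (σ.comp (face i)) 1 := by
  simp [boundary]

theorem push_single {m k : ℕ} (σ : C(stdSimplex ℝ (Fin m), X))
    (v : Fin (k + 1) → stdSimplex ℝ (Fin m)) (q : ℚ) :
    push σ k (Finsupp.single v q) = Finsupp.single (σ.comp (simplexAff v)) q := by
  simp [push]

theorem push_fundamental {k : ℕ} (σ : C(stdSimplex ℝ (Fin (k + 1)), X)) :
    push σ k (fundamental (k + 1)) = Finsupp.single σ 1 := by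
  rw [fundamental, push_single, simplexAff_vertex_eq_id, ContinuousMap.comp_id]

theorem push_comp {m j k : ℕ} (σ : C(stdSimplex ℝ (Fin m), X))
    (v : Fin j → stdSimplex ℝ (Fin m)) (c : TupleChain (stdSimplex ℝ (Fin j)) (k + 1)) :
    push (σ.comp (simplexAff v)) k c = push σ k (TupleChain.map (simplexAff v) (k + 1) c) := by
  induction c using Finsupp.induction_linear with
  | zero => simp
  | add x y hx hy => simp only [map_add, hx, hy]
  | single w q =>
    rw [TupleChain.map_single, push_single, push_single]
    congr 1
    ext t
    simp only [ContinuousMap.comp_apply]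
    rw [simplexAff_simplexAff]

/-- Identities between operators on tuples thereby pass to singular chains. -/
theorem boundary_push {m k : ℕ} (σ : C(stdSimplex ℝ (Fin m), X))
    (c : TupleChain (stdSimplex ℝ (Fin m)) (k + 2)) :
    boundary k (push σ (k + 1) c) = push σ k (TupleChain.boundary (k + 1) c) := by
  induction c using Finsupp.induction_linear with
  | zero => simp
  | add x y hx hy => simp only [map_add, hx, hy]
  | single w q =>
    rw [← mul_one q, ← smul_eq_mul, ← Finsupp.smul_single]
    simp only [map_smul]
    congr 1
    rw [push_single, boundary_single, TupleChain.boundary_single, map_sum]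
    refine Finset.sum_congr rfl fun i _ => ?_
    rw [map_smul, push_single]
    congr 2
    ext t
    simp only [ContinuousMap.comp_apply]
    rw [simplexAff_simplexAff]
    congr 3
    ext1 j
    exact simplexAff_vertex w _

theorem boundary_comp_boundary (n : ℕ) : boundary (X := X) n ∘ₗ boundary (n + 1) = 0 := by
  refine Finsupp.lhom_ext' fun σ => LinearMap.ext_ring ?_
  change boundary n (boundary (n + 1) (Finsupp.single σ 1)) = 0
  rw [← push_fundamental σ, boundary_push, boundary_push, TupleChain.boundary_boundary, map_zero]

/-- The barycentric subdivision operator. -/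
noncomputable def subdiv (n : ℕ) : SingChain X n →ₗ[ℚ] SingChain X n :=
  Finsupp.linearCombination ℚ fun σ =>
    push σ n (TupleChain.subdiv tupleBarycenter (n + 1) (fundamental (n + 1)))

/-- The chain homotopy between the identity and the barycentric subdivision operator. -/
noncomputable def subdivHomotopy (n : ℕ) : SingChain X n →ₗ[ℚ] SingChain X (n + 1) :=
  Finsupp.linearCombination ℚ fun σ =>
    push σ (n + 1) (TupleChain.subdivHomotopy tupleBarycenter (n + 1) (fundamental (n + 1)))

theorem map_simplexAff_fundamental {k m : ℕ} (v : Fin k → stdSimplex ℝ (Fin m)) :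
    TupleChain.map (simplexAff v) k (fundamental k) = Finsupp.single v 1 := by
  rw [fundamental, TupleChain.map_single]
  congr 1
  ext1 i
  simp [simplexAff_vertex]

/-- Subdividing an affine simplex inside `σ` can be done in the domain of `σ`, since affine maps
commute with subdivision. -/
theorem subdiv_push {m k : ℕ} (σ : C(stdSimplex ℝ (Fin m), X))
    (c : TupleChain (stdSimplex ℝ (Fin m)) (k + 1)) :
    subdiv k (push σ k c) = push σ k (TupleChain.subdiv tupleBarycenter (k + 1) c) := by
  induction c using Finsupp.induction_linear with
  | zero => simp
  | add x y hx hy => simp only [map_add, hx, hy]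
  | single w q =>
    rw [← mul_one q, ← smul_eq_mul, ← Finsupp.smul_single]
    simp only [map_smul]
    congr 1
    rw [push_single, subdiv, Finsupp.linearCombination_single, one_smul, push_comp,
      TupleChain.map_subdiv (simplexAff_tupleBarycenter w), map_simplexAff_fundamental]

theorem subdivHomotopy_push {m k : ℕ} (σ : C(stdSimplex ℝ (Fin m), X))
    (c : TupleChain (stdSimplex ℝ (Fin m)) (k + 1)) :
    subdivHomotopy k (push σ k c) =
      push σ (k + 1) (TupleChain.subdivHomotopy tupleBarycenter (k + 1) c) := by
  induction c using Finsupp.induction_linear with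
  | zero => simp
  | add x y hx hy => simp only [map_add, hx, hy]
  | single w q =>
    rw [← mul_one q, ← smul_eq_mul, ← Finsupp.smul_single]
    simp only [map_smul]
    congr 1
    rw [push_single, subdivHomotopy, Finsupp.linearCombination_single, one_smul, push_comp,
      TupleChain.map_subdivHomotopy (simplexAff_tupleBarycenter w), map_simplexAff_fundamental]

theorem linearMap_ext {M : Type*} [AddCommGroup M] [Module ℚ M] {n : ℕ}
    {f g : SingChain X n →ₗ[ℚ] M}
    (h : ∀ σ, f (push σ n (fundamental (n + 1))) = g (push σ n (fundamental (n + 1))))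
    (c : SingChain X n) : f c = g c := by
  congr 1
  refine Finsupp.lhom_ext' fun σ => LinearMap.ext_ring ?_
  have := h σ
  rw [push_fundamental] at this
  exact this

theorem boundary_subdiv {n : ℕ} (c : SingChain X (n + 1)) :
    boundary n (subdiv (n + 1) c) = subdiv n (boundary n c) :=
  linearMap_ext (f := boundary n ∘ₗ subdiv (n + 1)) (g := subdiv n ∘ₗ boundary n) (fun σ => by
    simp only [LinearMap.comp_apply]
    rw [subdiv_push, boundary_push, boundary_push, subdiv_push, TupleChain.boundary_subdiv]) c

theorem boundary_subdivHomotopy {n : ℕ} (c : SingChain X (n + 1)) :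
    boundary (n + 1) (subdivHomotopy (n + 1) c) =
      c - subdiv (n + 1) c - subdivHomotopy n (boundary n c) :=
  linearMap_ext (f := boundary (n + 1) ∘ₗ subdivHomotopy (n + 1))
    (g := LinearMap.id - subdiv (n + 1) - subdivHomotopy n ∘ₗ boundary n) (fun σ => by
    simp only [LinearMap.comp_apply, LinearMap.sub_apply, LinearMap.id_apply]
    rw [subdivHomotopy_push, boundary_push, subdiv_push, TupleChain.boundary_subdivHomotopy,
      map_sub, map_sub, boundary_push, subdivHomotopy_push]) c

end SingChain

/-! ### Small singular simplices -/

/-- All coordinates of the points of a tuple differ by at most `ε`. -/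
def TupleFine {k m : ℕ} (v : Fin k → stdSimplex ℝ (Fin m)) (ε : ℝ) : Prop :=
  ∀ i j l, |v i l - v j l| ≤ ε

/-- Convexity: a bound at the vertices of an affine simplex holds at all its points. -/
theorem abs_simplexAff_sub_le {k m : ℕ} (v : Fin k → stdSimplex ℝ (Fin m)) (l : Fin m) (a ε : ℝ)
    (h : ∀ i, |a - v i l| ≤ ε) (t : stdSimplex ℝ (Fin k)) : |a - simplexAff v t l| ≤ ε := by
  have e : a - simplexAff v t l = ∑ i, t i * (a - v i l) := by
    simp only [mul_sub, Finset.sum_sub_distrib, ← Finset.sum_mul, stdSimplex.sum_eq_one, one_mul,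
      simplexAff_apply]
  calc |a - simplexAff v t l| ≤ ∑ i, |t i * (a - v i l)| := by
        rw [e]; exact Finset.abs_sum_le_sum_abs _ _
    _ ≤ ∑ i, t i * ε := Finset.sum_le_sum fun i _ => by
        rw [abs_mul, abs_of_nonneg (stdSimplex.zero_le t i)]
        exact mul_le_mul_of_nonneg_left (h i) (stdSimplex.zero_le t i)
    _ = ε := by rw [← Finset.sum_mul, stdSimplex.sum_eq_one, one_mul]

theorem abs_tupleBarycenter_sub_le {k m : ℕ} {v : Fin (k + 1) → stdSimplex ℝ (Fin m)} {ε : ℝ}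
    (h : TupleFine v ε) (i : Fin (k + 1)) (l : Fin m) :
    |tupleBarycenter k v l - v i l| ≤ (1 - 1 / (k + 1)) * ε := by
  have hk : (0 : ℝ) < k + 1 := by positivity
  have e : tupleBarycenter k v l - v i l = (1 / (k + 1)) * ∑ j, (v j l - v i l) := by
    have : tupleBarycenter k v l = ∑ j, (1 / (k + 1)) * v j l := by
      rw [tupleBarycenter, simplexAff_apply]
      refine Finset.sum_congr rfl fun j _ => ?_
      congr 1
      exact (stdSimplex.barycenter_apply j).trans (by simp)
    rw [this, Finset.sum_sub_distrib, ← Finset.mul_sum]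
    simp
    field_simp
  -- The term `j = i` vanishes. Only `k` of the `k + 1` terms remain, whence the factor `k / (k +
  -- 1)`.
  have hs : |∑ j, (v j l - v i l)| ≤ k * ε := by
    rw [← Finset.add_sum_erase _ _ (Finset.mem_univ i), sub_self, zero_add]
    refine (Finset.abs_sum_le_sum_abs _ _).trans ((Finset.sum_le_card_nsmul _ _ ε
      fun j _ => h j i l).trans_eq ?_)
    simp
  rw [e, abs_mul, abs_of_pos (by positivity)]
  calc 1 / ((k : ℝ) + 1) * |∑ j, (v j l - v i l)| ≤ 1 / ((k : ℝ) + 1) * (k * ε) := by gcongr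
    _ = _ := by field_simp; ring

theorem Finsupp.exists_of_mem_support_linearCombination {α β : Type*} {f : α → β →₀ ℚ}
    {c : α →₀ ℚ} {b : β} (h : b ∈ (Finsupp.linearCombination ℚ f c).support) :
    ∃ a ∈ c.support, b ∈ (f a).support := by
  by_contra! hc
  refine (Finsupp.mem_support_iff.mp h) ?_
  rw [Finsupp.linearCombination_apply, Finsupp.sum, Finsupp.finsetSum_apply]
  refine Finset.sum_eq_zero fun a ha => ?_
  rw [Finsupp.smul_apply, Finsupp.notMem_support_iff.mp (hc a ha), smul_zero]

theorem exists_of_mem_support_boundary {V : Type} {k : ℕ} {v : Fin (k + 1) → V} {w : Fin k → V}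
    (h : w ∈ (TupleChain.boundary k (Finsupp.single v 1)).support) :
    ∃ i : Fin (k + 1), w = v ∘ i.succAbove := by
  by_contra! hc
  refine (Finsupp.mem_support_iff.mp h) ?_
  rw [TupleChain.boundary_single, Finsupp.finsetSum_apply]
  refine Finset.sum_eq_zero fun i _ => ?_
  rw [Finsupp.smul_apply, Finsupp.single_eq_of_ne (hc i), smul_zero]

theorem exists_of_mem_support_cone {V : Type} {k : ℕ} {b : V} {c : TupleChain V k}
    {w : Fin (k + 1) → V} (h : w ∈ (TupleChain.cone b k c).support) :
    ∃ w' ∈ c.support, w = Fin.cons b w' := by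
  classical
  have := Finsupp.mapDomain_support h
  obtain ⟨w', h1, h2⟩ := Finset.mem_image.mp this
  exact ⟨w', h1, h2.symm⟩

/-- A simplex of the subdivision is a cone from the barycenter over a simplex of the subdivision of
a facet. Pairs with the apex are controlled by the barycenter estimate and convexity, which is what
the first conclusion serves; the other pairs by induction, with a smaller factor. -/
theorem mem_support_subdiv_single {m : ℕ} : ∀ (k : ℕ) (v : Fin k → stdSimplex ℝ (Fin m)) (ε : ℝ),
    0 ≤ ε → TupleFine v ε →
    ∀ w ∈ (TupleChain.subdiv tupleBarycenter k (Finsupp.single v 1)).support,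
      (∀ j, ∃ t, w j = simplexAff v t) ∧ TupleFine w ((1 - 1 / k) * ε) := by
  intro k
  induction k with
  | zero => exact fun v ε _ _ w _ => ⟨fun j => j.elim0, fun j => j.elim0⟩
  | succ k ih =>
    intro v ε hε hv w hw
    rw [TupleChain.subdiv_single] at hw
    obtain ⟨w', hw', rfl⟩ := exists_of_mem_support_cone hw
    have hsub : ∃ u ∈ (TupleChain.boundary k (Finsupp.single v 1)).support,
        w' ∈ (TupleChain.subdiv tupleBarycenter k (Finsupp.single u 1)).support := by
      -- For `k = 0` subdivision is the identity on chains of empty tuples, not a linear extension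
      -- from cones.
      rcases k with _ | k
      · refine ⟨w', ?_, ?_⟩
        · simpa [TupleChain.subdiv] using hw'
        · simp [TupleChain.subdiv]
      · rw [TupleChain.subdiv] at hw'
        obtain ⟨u, h1, h2⟩ := Finsupp.exists_of_mem_support_linearCombination hw'
        exact ⟨u, h1, by rwa [TupleChain.subdiv_single]⟩
    obtain ⟨u, hu, hw'⟩ := hsub
    obtain ⟨i, rfl⟩ := exists_of_mem_support_boundary hu
    obtain ⟨h1, h2⟩ := ih (v ∘ i.succAbove) ε hε (fun a b l => hv _ _ l) w' hw'
    have h1' : ∀ j, ∃ t, w' j = simplexAff v t := fun j => by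
      obtain ⟨t, ht⟩ := h1 j
      refine ⟨simplexAff (stdSimplex.vertex ∘ i.succAbove) t, ?_⟩
      rw [ht, simplexAff_simplexAff]
      congr 2
      ext1 a
      simp [simplexAff_vertex]
    have hb : ∀ j l, |tupleBarycenter k v l - w' j l| ≤ (1 - 1 / ((k + 1 : ℕ) : ℝ)) * ε := by
      intro j l
      obtain ⟨t, ht⟩ := h1' j
      rw [ht]
      push_cast
      exact abs_simplexAff_sub_le v l _ _ (fun i => abs_tupleBarycenter_sub_le hv i l) t
    refine ⟨fun j => ?_, fun j j' l => ?_⟩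
    · refine Fin.cases ?_ (fun j => ?_) j
      · exact ⟨_, rfl⟩
      · simpa using h1' j
    · have h0 : 0 ≤ (1 - 1 / ((k + 1 : ℕ) : ℝ)) * ε := by
        refine mul_nonneg (sub_nonneg.mpr ?_) hε
        rw [div_le_one (by positivity)]
        push_cast
        linarith [(Nat.cast_nonneg k : (0 : ℝ) ≤ k)]
      refine Fin.cases ?_ (fun j => ?_) j <;> refine Fin.cases ?_ (fun j' => ?_) j' <;>
        simp only [Fin.cons_zero, Fin.cons_succ]
      · simpa using h0
      · exact hb j' l
      · rw [abs_sub_comm]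
        exact hb j l
      · refine (h2 j j' l).trans (mul_le_mul_of_nonneg_right ?_ hε)
        rcases k with _ | k
        · exact j.elim0
        · gcongr
          omega

theorem mem_support_subdiv {m k : ℕ} {c : TupleChain (stdSimplex ℝ (Fin m)) (k + 1)} {ε : ℝ}
    (hε : 0 ≤ ε) (hc : ∀ v ∈ c.support, TupleFine v ε) :
    ∀ w ∈ (TupleChain.subdiv tupleBarycenter (k + 1) c).support,
      TupleFine w ((1 - 1 / ((k + 1 : ℕ) : ℝ)) * ε) := by
  intro w hw
  rw [TupleChain.subdiv] at hw
  obtain ⟨v, h1, h2⟩ := Finsupp.exists_of_mem_support_linearCombination hw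
  rw [← TupleChain.subdiv_single] at h2
  exact (mem_support_subdiv_single _ v ε hε (hc v h1) w h2).2

theorem mem_support_subdiv_iterate (k r : ℕ) :
    ∀ w ∈ ((TupleChain.subdiv tupleBarycenter (k + 1))^[r]
        (SingChain.fundamental (k + 1))).support,
      TupleFine w ((1 - 1 / ((k + 1 : ℕ) : ℝ)) ^ r) := by
  have hq : (0 : ℝ) ≤ 1 - 1 / ((k + 1 : ℕ) : ℝ) := by
    rw [sub_nonneg, div_le_one (by positivity)]
    push_cast
    linarith [(Nat.cast_nonneg k : (0 : ℝ) ≤ k)]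
  induction r with
  | zero =>
    -- Coordinates lie in `[0, 1]`, so every tuple is fine with `ε = 1`.
    intro w _ i j l
    rw [pow_zero, abs_le]
    have := stdSimplex.zero_le (w i) l
    have := stdSimplex.zero_le (w j) l
    have := stdSimplex.le_one (w i) l
    have := stdSimplex.le_one (w j) l
    constructor <;> linarith
  | succ r ih =>
    rw [Function.iterate_succ_apply', pow_succ']
    exact mem_support_subdiv (pow_nonneg hq r) ih

/-! ### Small chains and the Mayer-Vietoris property -/

namespace SingChain

variable {X : Type} [TopologicalSpace X]

/-- The singular chains in a subset. -/
noncomputable def inside (A : Set X) (n : ℕ) : Submodule ℚ (SingChain X n) :=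
  Finsupp.supported ℚ ℚ {σ | range σ ⊆ A}

theorem single_mem_inside {A : Set X} {n : ℕ} {σ : C(stdSimplex ℝ (Fin (n + 1)), X)}
    (h : range σ ⊆ A) (q : ℚ) : Finsupp.single σ q ∈ inside A n :=
  Finsupp.single_mem_supported _ _ h

theorem push_mem_inside {A : Set X} {m n : ℕ} {σ : C(stdSimplex ℝ (Fin m), X)}
    (h : range σ ⊆ A) (c : TupleChain (stdSimplex ℝ (Fin m)) (n + 1)) :
    push σ n c ∈ inside A n := by
  induction c using Finsupp.induction_linear with
  | zero => simp
  | add x y hx hy => rw [map_add]; exact add_mem hx hy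
  | single w q =>
    rw [push_single]
    exact single_mem_inside (range_subset_iff.mpr fun t => h (mem_range_self _)) _

theorem induction_inside {A : Set X} {n : ℕ} {p : SingChain X n → Prop} (h0 : p 0)
    (hadd : ∀ x y, p x → p y → p (x + y)) (hsmul : ∀ (q : ℚ) x, p x → p (q • x))
    (hs : ∀ σ : C(stdSimplex ℝ (Fin (n + 1)), X), range σ ⊆ A → p (push σ n (fundamental (n + 1))))
    {x : SingChain X n} (hx : x ∈ inside A n) : p x := by
  rw [inside, Finsupp.supported_eq_span_single] at hx
  refine Submodule.span_induction ?_ h0 (fun x y _ _ => hadd x y) (fun q x _ => hsmul q x) hx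
  rintro _ ⟨σ, hσ, rfl⟩
  have := hs σ hσ
  rwa [push_fundamental] at this

theorem boundary_mem_inside {A : Set X} (n : ℕ) :
    ∀ x ∈ inside A (n + 1), boundary n x ∈ inside A n := by
  intro x hx
  refine induction_inside (p := fun x => boundary n x ∈ inside A n) ?_ ?_ ?_ ?_ hx
  · simp
  · intro x y hx hy
    rw [map_add]
    exact add_mem hx hy
  · intro q x hx
    rw [map_smul]
    exact Submodule.smul_mem _ _ hx
  · intro σ hσ
    rw [boundary_push]
    exact push_mem_inside hσ _

theorem subdiv_mem_inside {A : Set X} (n : ℕ) :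
    ∀ x ∈ inside A n, subdiv n x ∈ inside A n := by
  intro x hx
  refine induction_inside (p := fun x => subdiv n x ∈ inside A n) ?_ ?_ ?_ ?_ hx
  · simp
  · intro x y hx hy
    rw [map_add]
    exact add_mem hx hy
  · intro q x hx
    rw [map_smul]
    exact Submodule.smul_mem _ _ hx
  · intro σ hσ
    rw [subdiv_push]
    exact push_mem_inside hσ _

theorem subdivHomotopy_mem_inside {A : Set X} (n : ℕ) :
    ∀ x ∈ inside A n, subdivHomotopy n x ∈ inside A (n + 1) := by
  intro x hx
  refine induction_inside (p := fun x => subdivHomotopy n x ∈ inside A (n + 1)) ?_ ?_ ?_ ?_ hx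
  · simp
  · intro x y hx hy
    rw [map_add]
    exact add_mem hx hy
  · intro q x hx
    rw [map_smul]
    exact Submodule.smul_mem _ _ hx
  · intro σ hσ
    rw [subdivHomotopy_push]
    exact push_mem_inside hσ _

theorem inside_inf (A B : Set X) (n : ℕ) : inside A n ⊓ inside B n = inside (A ∩ B) n := by
  rw [inside, inside, inside, ← Finsupp.supported_inter]
  congr 1
  ext σ
  simp

theorem inside_mono {A B : Set X} (h : A ⊆ B) (n : ℕ) : inside A n ≤ inside B n :=
  Finsupp.supported_mono fun _ hσ => hσ.trans h

theorem mem_sup_of_mem_sup {A B : Set X} {m n : ℕ} (f : SingChain X m →ₗ[ℚ] SingChain X n)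
    (hf : ∀ C : Set X, ∀ x ∈ inside C m, f x ∈ inside C n) :
    ∀ x ∈ inside A m ⊔ inside B m, f x ∈ inside A n ⊔ inside B n := by
  intro x hx
  obtain ⟨a, ha, b, hb, rfl⟩ := Submodule.mem_sup.mp hx
  rw [map_add]
  exact Submodule.add_mem_sup (hf A a ha) (hf B b hb)

theorem iterate_subdiv_push {m k : ℕ} (σ : C(stdSimplex ℝ (Fin m), X))
    (c : TupleChain (stdSimplex ℝ (Fin m)) (k + 1)) (r : ℕ) :
    (subdiv k)^[r] (push σ k c) =
      push σ k ((TupleChain.subdiv tupleBarycenter (k + 1))^[r] c) := by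
  induction r with
  | zero => rfl
  | succ r ih => rw [Function.iterate_succ_apply', ih, subdiv_push, Function.iterate_succ_apply']

theorem iterate_subdiv_mem {A B : Set X} {n r s : ℕ} (hrs : r ≤ s) {x : SingChain X n}
    (hx : (subdiv n)^[r] x ∈ inside A n ⊔ inside B n) :
    (subdiv n)^[s] x ∈ inside A n ⊔ inside B n := by
  induction s, hrs using Nat.le_induction with
  | base => exact hx
  | succ s _ ih =>
    rw [Function.iterate_succ_apply']
    exact mem_sup_of_mem_sup _ (fun C => subdiv_mem_inside n) _ ih

/-- Every chain in the union of two open sets becomes small under iterated subdivision. -/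
theorem exists_iterate_subdiv_mem {A B : Set X} (hA : IsOpen A) (hB : IsOpen B) {n : ℕ}
    {x : SingChain X n} (hx : x ∈ inside (A ∪ B) n) :
    ∃ r, (subdiv n)^[r] x ∈ inside A n ⊔ inside B n := by
  refine induction_inside (p := fun x => ∃ r, (subdiv n)^[r] x ∈ inside A n ⊔ inside B n)
    ⟨0, by simp⟩ ?_ ?_ ?_ hx
  · rintro x y ⟨r, hr⟩ ⟨s, hs⟩
    refine ⟨max r s, ?_⟩
    rw [iterate_map_add]
    exact add_mem (iterate_subdiv_mem (le_max_left r s) hr)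
      (iterate_subdiv_mem (le_max_right r s) hs)
  · rintro q x ⟨r, hr⟩
    refine ⟨r, ?_⟩
    rw [← Module.End.pow_apply, map_smul, Module.End.pow_apply]
    exact Submodule.smul_mem _ _ hr
  · intro σ hσ
    -- A Lebesgue number for the preimages of `A` and `B`: once the mesh is below `δ`, each small
    -- simplex lies in the ball about its first vertex, hence in one of the two preimages.
    obtain ⟨δ, hδ, hball⟩ := lebesgue_number_lemma_of_metric (s := univ)
      (c := fun b : Bool => σ ⁻¹' (if b then A else B)) isCompact_univ
      (fun b => by cases b <;> simp [hA.preimage σ.continuous, hB.preimage σ.continuous]) (by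
        intro t _
        have := hσ (mem_range_self t)
        simp only [mem_iUnion, Bool.exists_bool]
        rcases this with h | h
        · exact Or.inr h
        · exact Or.inl h)
    have hq0 : (0 : ℝ) ≤ 1 - 1 / ((n + 1 : ℕ) : ℝ) := by
      rw [sub_nonneg, div_le_one (by positivity)]
      push_cast
      linarith [(Nat.cast_nonneg n : (0 : ℝ) ≤ n)]
    have hq1 : 1 - 1 / ((n + 1 : ℕ) : ℝ) < 1 := by
      rw [sub_lt_self_iff]
      positivity
    obtain ⟨r, hr⟩ := exists_pow_lt_of_lt_one hδ hq1
    refine ⟨r, ?_⟩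
    rw [iterate_subdiv_push]
    set c := (TupleChain.subdiv tupleBarycenter (n + 1))^[r] (fundamental (n + 1)) with hc
    rw [← Finsupp.sum_single c, Finsupp.sum, map_sum]
    refine sum_mem fun w hw => ?_
    rw [push_single]
    have hfine := mem_support_subdiv_iterate n r w hw
    obtain ⟨b, hb⟩ := hball (w 0) (mem_univ _)
    have hsub : range (σ.comp (simplexAff w)) ⊆ if b then A else B := by
      rintro _ ⟨t, rfl⟩
      refine hb ?_
      rw [Metric.mem_ball, Subtype.dist_eq]
      refine lt_of_le_of_lt ?_ hr
      rw [dist_pi_le_iff (pow_nonneg hq0 r)]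
      intro l
      rw [dist_comm, Real.dist_eq]
      exact abs_simplexAff_sub_le w l _ _ (fun i => hfine 0 i l) t
    cases b
    · exact Submodule.mem_sup_right (single_mem_inside hsub _)
    · exact Submodule.mem_sup_left (single_mem_inside hsub _)

/-- The complex of singular chains in a subset. -/
noncomputable def insideComplex (A : Set X) : ChainComplex (ModuleCat.{0} ℚ) ℕ :=
  subComplex (P := inside A) boundary_comp_boundary boundary_mem_inside

/-- Modulo boundaries, `z` differs from its subdivision by the homotopy applied to the boundary of
`z`. That term is small because the boundary is, and the argument iterates. -/
theorem exists_sub_boundary_mem {A B : Set X} {n : ℕ} (r : ℕ) {z : SingChain X (n + 1)}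
    (hz : z ∈ inside (A ∪ B) (n + 1)) (hdz : boundary n z ∈ inside A n ⊔ inside B n) :
    ∃ w ∈ inside (A ∪ B) (n + 2),
      z - boundary (n + 1) w - (subdiv (n + 1))^[r] z ∈ inside A (n + 1) ⊔ inside B (n + 1) := by
  induction r generalizing z with
  | zero => exact ⟨0, zero_mem _, by simp⟩
  | succ r ih =>
    obtain ⟨w, hw, h⟩ := ih (subdiv_mem_inside _ z hz) (by
      rw [boundary_subdiv]
      exact mem_sup_of_mem_sup _ (fun C => subdiv_mem_inside n) _ hdz)
    refine ⟨w + subdivHomotopy (n + 1) z, add_mem hw (subdivHomotopy_mem_inside _ z hz), ?_⟩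
    have := add_mem h (mem_sup_of_mem_sup _ (fun C => subdivHomotopy_mem_inside n) _ hdz)
    convert this using 1
    rw [map_add, boundary_subdivHomotopy, Function.iterate_succ_apply]
    abel

/-- The Mayer-Vietoris property of the Euler characteristic, for two open sets. -/
theorem hasEuler_union {A B : Set X} (hA : IsOpen A) (hB : IsOpen B) {a b c : ℤ}
    (ha : HasEuler (insideComplex A) a) (hb : HasEuler (insideComplex B) b)
    (hc : HasEuler (insideComplex (A ∩ B)) c) :
    HasEuler (insideComplex (A ∪ B)) (a + b - c) := by
  have hI : (fun n => inside A n ⊓ inside B n) = inside (A ∩ B) := funext fun n => inside_inf A B n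
  have hc' : HasEuler (subComplex (P := fun n => inside A n ⊓ inside B n) boundary_comp_boundary
      fun n x hx => ⟨boundary_mem_inside n x hx.1, boundary_mem_inside n x hx.2⟩) c :=
    HasEuler.subComplex_congr _ hI.symm hc
  have := HasEuler.sup boundary_comp_boundary
    (hS := fun n => mem_sup_of_mem_sup _ fun C => boundary_mem_inside n) ha hb hc'
  refine HasEuler.of_relative_exact _ ?_ ?_ ?_ this
  · exact fun n => sup_le (inside_mono subset_union_left n) (inside_mono subset_union_right n)
  -- In degree `0` no subdivision is needed: a singular simplex is a single point, which lies in `A`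
  -- or in `B`.
  · intro z hz
    refine ⟨0, zero_mem _, ?_⟩
    rw [map_zero, sub_zero]
    refine induction_inside (p := fun z => z ∈ inside A 0 ⊔ inside B 0) (zero_mem _)
      (fun x y => add_mem) (fun q x => Submodule.smul_mem _ q) ?_ hz
    intro σ hσ
    rw [push_fundamental]
    have h1 : range σ = {σ default} := by
      ext y
      constructor
      · rintro ⟨t, rfl⟩
        rw [Subsingleton.elim t default]
        rfl
      · rintro rfl
        exact mem_range_self _
    have h2 := hσ (mem_range_self default)
    rcases h2 with h | h
    · exact Submodule.mem_sup_left (single_mem_inside (by rw [h1]; simpa using h) _)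
    · exact Submodule.mem_sup_right (single_mem_inside (by rw [h1]; simpa using h) _)
  · intro n z hz hdz
    obtain ⟨r, hr⟩ := exists_iterate_subdiv_mem hA hB hz
    obtain ⟨w, hw, h⟩ := exists_sub_boundary_mem r hz hdz
    exact ⟨w, hw, by simpa using add_mem h hr⟩

end SingChain

section

/-! ### Comparison with the singular chain complex -/

open CategoryTheory Limits Simplicial

namespace SingChain

/-- The functorial map of singular chains. -/
noncomputable def map {X Y : Type} [TopologicalSpace X] [TopologicalSpace Y] (f : C(X, Y)) (n : ℕ) :
    SingChain X n →ₗ[ℚ] SingChain Y n :=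
  Finsupp.lmapDomain ℚ ℚ fun σ => f.comp σ

theorem boundary_map {X Y : Type} [TopologicalSpace X] [TopologicalSpace Y] (f : C(X, Y)) (n : ℕ)
    (x : SingChain X (n + 1)) : boundary n (map f (n + 1) x) = map f n (boundary n x) := by
  induction x using Finsupp.induction_linear with
  | zero => simp
  | add x y hx hy => simp only [map_add, hx, hy]
  | single σ q =>
    rw [← mul_one q, ← smul_eq_mul, ← Finsupp.smul_single]
    simp only [map_smul]
    congr 1
    simp only [map, Finsupp.lmapDomain_apply, Finsupp.mapDomain_single, boundary_single,
      Finsupp.mapDomain_finsetSum, Finsupp.mapDomain_smul]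
    rfl

/-- The complex of singular chains. -/
noncomputable def complex (X : Type) [TopologicalSpace X] : ChainComplex (ModuleCat.{0} ℚ) ℕ :=
  linComplex (SingChain X) boundary boundary_comp_boundary

theorem range_map_val {X : Type} [TopologicalSpace X] (A : Set X) (n : ℕ) :
    LinearMap.range (map (⟨Subtype.val, continuous_subtype_val⟩ : C(A, X)) n) = inside A n := by
  apply le_antisymm
  · rintro _ ⟨x, rfl⟩
    induction x using Finsupp.induction_linear with
    | zero => simp
    | add x y hx hy => rw [map_add]; exact add_mem hx hy
    | single σ q =>
      simp only [map, Finsupp.lmapDomain_apply, Finsupp.mapDomain_single]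
      exact single_mem_inside (by rintro _ ⟨t, rfl⟩; exact (σ t).2) q
  · intro x hx
    refine induction_inside (p := fun x => x ∈ LinearMap.range _) (zero_mem _)
      (fun x y => add_mem) (fun q x => Submodule.smul_mem _ q) ?_ hx
    intro σ hσ
    rw [push_fundamental]
    refine ⟨Finsupp.single ⟨fun t => ⟨σ t, hσ (mem_range_self t)⟩,
      σ.continuous.subtype_mk _⟩ 1, ?_⟩
    simp only [map, Finsupp.lmapDomain_apply, Finsupp.mapDomain_single]
    rfl

theorem map_val_injective {X : Type} [TopologicalSpace X] (A : Set X) (n : ℕ) :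
    Function.Injective (map (⟨Subtype.val, continuous_subtype_val⟩ : C(A, X)) n) := by
  refine Finsupp.mapDomain_injective fun σ τ h => ?_
  ext t
  exact congrArg (fun f : C(_, X) => f t) h

/-- The singular chains of a subspace are the singular chains in the subset. -/
noncomputable def complexIsoInside {X : Type} [TopologicalSpace X] (A : Set X) :
    complex A ≅ insideComplex A :=
  linComplexIso (h₂ := fun n => by
      refine LinearMap.ext fun x => Subtype.ext ?_
      exact LinearMap.congr_fun (boundary_comp_boundary n) (x : SingChain X (n + 2)))
    (fun n => (LinearEquiv.ofInjective _ (map_val_injective A n)).trans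
    (LinearEquiv.ofEq _ _ (range_map_val A n))) fun n x => Subtype.ext (boundary_map _ n x)

/-- Finitely supported functions form a coproduct of copies of the ground field. -/
noncomputable def isColimitFinsupp {ι κ : Type} (e : ι ≃ κ) :
    IsColimit (Cofan.mk (f := fun _ : ι => ModuleCat.of ℚ ℚ) (ModuleCat.of ℚ (κ →₀ ℚ))
      fun x => ModuleCat.ofHom (Finsupp.lsingle (e x))) :=
  Cofan.IsColimit.mk _ (fun s => ModuleCat.ofHom
      (Finsupp.lsum ℚ fun k => (s.inj (e.symm k)).hom))
    (fun s j => by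
      ext
      simp)
    (fun s m h => by
      ext1
      refine Finsupp.lhom_ext' fun k => ?_
      have := congrArg ModuleCat.Hom.hom (h (e.symm k))
      refine LinearMap.ext_ring ?_
      simpa using LinearMap.congr_fun this (1 : ℚ))

variable (X : Type) [TopologicalSpace X]

/-- The chain groups of the singular chain complex. -/
noncomputable def singularXIso (n : ℕ) :
    ((TopCat.toSSet.obj (TopCat.of X)).chainComplex (ModuleCat.of ℚ ℚ)).X n ≅
      ModuleCat.of ℚ (SingChain X n) :=
  ((TopCat.toSSet.obj (TopCat.of X)).isColimitChainComplexXCofan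
    (ModuleCat.of ℚ ℚ) n).coconePointUniqueUpToIso
    (isColimitFinsupp (TopCat.toSSetObjEquiv (TopCat.of X) (.op ⦋n⦌)))

theorem ι_singularXIso (n : ℕ) (x : (TopCat.toSSet.obj (TopCat.of X)) _⦋n⦌) :
    (TopCat.toSSet.obj (TopCat.of X)).ιChainComplex x ≫ (singularXIso X n).hom =
      ModuleCat.ofHom (Finsupp.lsingle (TopCat.toSSetObjEquiv (TopCat.of X) (.op ⦋n⦌) x)) :=
  ((TopCat.toSSet.obj (TopCat.of X)).isColimitChainComplexXCofan
    (ModuleCat.of ℚ ℚ) n).comp_coconePointUniqueUpToIso_hom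
    (isColimitFinsupp (TopCat.toSSetObjEquiv (TopCat.of X) (.op ⦋n⦌))) ⟨x⟩

theorem stdSimplex_map_eq {k m : ℕ} (f : Fin k → Fin m) (t : stdSimplex ℝ (Fin k)) :
    stdSimplex.map f t = simplexAff (stdSimplex.vertex ∘ f) t := by
  ext l
  simp [simplexAff_apply, FunOnFinite.linearMap_apply_apply, Pi.single_apply, Finset.sum_filter,
    eq_comm]

theorem toSSetObjEquiv_δ (n : ℕ) (x : (TopCat.toSSet.obj (TopCat.of X)) _⦋n + 1⦌)
    (i : Fin (n + 2)) :
    TopCat.toSSetObjEquiv (TopCat.of X) (.op ⦋n⦌) ((TopCat.toSSet.obj (TopCat.of X)).δ i x) =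
      (TopCat.toSSetObjEquiv (TopCat.of X) (.op ⦋n + 1⦌) x).comp (face i) := by
  ext t
  rw [ContinuousMap.comp_apply, ← stdSimplex_map_eq]
  rfl

/-- Both maps are compared on the summand of each singular simplex, where they give the same
alternating sum of faces. -/
theorem singularXIso_comm (n : ℕ) :
    (singularXIso X (n + 1)).hom ≫ ModuleCat.ofHom (boundary n) =
      ((TopCat.toSSet.obj (TopCat.of X)).chainComplex (ModuleCat.of ℚ ℚ)).d (n + 1) n ≫
        (singularXIso X n).hom := by
  refine SSet.chainComplex_hom_ext fun x => ?_
  rw [reassoc_of% (ι_singularXIso X (n + 1) x), SSet.ιChainComplex_d_assoc,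
    Preadditive.sum_comp]
  simp only [Preadditive.zsmul_comp, ι_singularXIso]
  refine ModuleCat.hom_ext (LinearMap.ext_ring ?_)
  refine (boundary_single _).trans ?_
  rw [ModuleCat.hom_sum, LinearMap.sum_apply]
  refine Finset.sum_congr rfl fun i _ => ?_
  rw [← toSSetObjEquiv_δ]
  simp

/-- The singular chain complex consists of the formal linear combinations of singular simplices. -/
noncomputable def singularIso :
    ((AlgebraicTopology.singularChainComplexFunctor (ModuleCat.{0} ℚ)).obj
      (ModuleCat.of ℚ ℚ)).obj (TopCat.of X) ≅ complex X :=
  HomologicalComplex.Hom.isoOfComponents (singularXIso X) fun i j hij => by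
    obtain rfl : j + 1 = i := hij
    refine Eq.trans ?_ (singularXIso_comm X j)
    exact congrArg ((singularXIso X (j + 1)).hom ≫ ·) (linComplex_d (h₁ := boundary_comp_boundary) j)

end SingChain

end

section

/-! ### The Euler characteristic of a space with a good cover -/

open CategoryTheory Limits

/-- The singular chain complex with rational coefficients. -/
noncomputable abbrev singularComplex (X : Type) [TopologicalSpace X] :
    ChainComplex (ModuleCat.{0} ℚ) ℕ :=
  ((AlgebraicTopology.singularChainComplexFunctor (ModuleCat.{0} ℚ)).obj
    (ModuleCat.of ℚ ℚ)).obj (TopCat.of X)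

/-- Homotopy invariance. -/
theorem HasEuler.of_homotopyEquiv {X Y : Type} [TopologicalSpace X] [TopologicalSpace Y]
    (h : ContinuousMap.HomotopyEquiv X Y) {e : ℤ} (hX : HasEuler (singularComplex X) e) :
    HasEuler (singularComplex Y) e := by
  let F := (AlgebraicTopology.singularChainComplexFunctor (ModuleCat.{0} ℚ)).obj (ModuleCat.of ℚ ℚ)
  let f : TopCat.of X ⟶ TopCat.of Y := TopCat.ofHom h.toFun
  let g : TopCat.of Y ⟶ TopCat.of X := TopCat.ofHom h.invFun
  refine hX.of_homology_equiv fun n => ⟨Iso.toLinearEquiv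
    ⟨HomologicalComplex.homologyMap (F.map f) n, HomologicalComplex.homologyMap (F.map g) n, ?_, ?_⟩⟩
  · obtain ⟨H⟩ := h.left_inv
    have := TopCat.Homotopy.congr_homologyMap_singularChainComplexFunctor
      (f := f ≫ g) (g := 𝟙 (TopCat.of X)) H (ModuleCat.of ℚ ℚ) n
    rw [← HomologicalComplex.homologyMap_comp, ← F.map_comp]
    refine this.trans ?_
    rw [CategoryTheory.Functor.map_id, HomologicalComplex.homologyMap_id]
  · obtain ⟨H⟩ := h.right_inv
    have := TopCat.Homotopy.congr_homologyMap_singularChainComplexFunctor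
      (f := g ≫ f) (g := 𝟙 (TopCat.of Y)) H (ModuleCat.of ℚ ℚ) n
    rw [← HomologicalComplex.homologyMap_comp, ← F.map_comp]
    refine this.trans ?_
    rw [CategoryTheory.Functor.map_id, HomologicalComplex.homologyMap_id]

/-- The homology of a totally disconnected space is concentrated in degree `0`, where it is free on
the points. -/
theorem hasEuler_of_finite_discrete (D : Type) [TopologicalSpace D] [DiscreteTopology D]
    [Finite D] : HasEuler (singularComplex D) (Nat.card D) := by
  have hn : ∀ n, n ≠ 0 → Subsingleton ((singularComplex D).homology n) := fun n hn =>
    ModuleCat.subsingleton_of_isZero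
      (AlgebraicTopology.isZero_singularHomologyFunctor_of_totallyDisconnectedSpace _ n
        (ModuleCat.of ℚ ℚ) (TopCat.of D) hn)
  have e0 : (singularComplex D).homology 0 ≃ₗ[ℚ] (D →₀ ℚ) :=
    (AlgebraicTopology.singularHomologyFunctorZeroOfTotallyDisconnectedSpace _
      (ModuleCat.of ℚ ℚ) (TopCat.of D) ≪≫ (coproductIsCoproduct _).coconePointUniqueUpToIso
        (SingChain.isColimitFinsupp (Equiv.refl D))).toLinearEquiv
  refine ⟨fun n => ?_, ⟨1, fun n h => hn n (by omega)⟩, ?_⟩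
  · by_cases h : n = 0
    · subst h
      exact e0.symm.finiteDimensional
    · have := hn n h
      infer_instance
  · rw [homologyEulerChar_eq_sum_range (N := 1) fun n h => hn n (by omega)]
    have := Fintype.ofFinite D
    rw [Finset.sum_range_one, e0.finrank_eq]
    simp

/-- A deformation retraction of a subset `W` of a space onto a subset `D` of `W`. -/
structure DeformationRetraction {X : Type} [TopologicalSpace X] (W D : Set X) where
  /-- the homotopy -/
  toFun : unitInterval × W → X
  continuous_toFun : Continuous toFun
  mem : ∀ p, toFun p ∈ W
  apply_zero : ∀ w, toFun (0, w) = w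
  apply_one : ∀ w, toFun (1, w) ∈ D
  subset : D ⊆ W
  apply_one_of_mem : ∀ w : W, (w : X) ∈ D → toFun (1, w) = w

/-- A deformation retract is homotopy equivalent to the ambient set. -/
noncomputable def DeformationRetraction.homotopyEquiv {X : Type} [TopologicalSpace X] {W D : Set X}
    (r : DeformationRetraction W D) : ContinuousMap.HomotopyEquiv D W where
  toFun := ⟨inclusion r.subset, continuous_inclusion _⟩
  invFun := ⟨fun w => ⟨r.toFun (1, w), r.apply_one w⟩,
    (r.continuous_toFun.comp (by fun_prop)).subtype_mk _⟩
  left_inv := by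
    have : (ContinuousMap.mk (fun w : W => (⟨r.toFun (1, w), r.apply_one w⟩ : D))
        ((r.continuous_toFun.comp (by fun_prop)).subtype_mk _)).comp
        ⟨inclusion r.subset, continuous_inclusion _⟩ = ContinuousMap.id D := by
      ext x
      exact r.apply_one_of_mem (inclusion r.subset x) x.2
    rw [this]
  right_inv := by
    refine ContinuousMap.Homotopic.symm ⟨⟨⟨fun p => ⟨r.toFun p, r.mem p⟩,
      r.continuous_toFun.subtype_mk _⟩, fun w => ?_, fun w => ?_⟩⟩
    · exact Subtype.ext (r.apply_zero w)
    · rfl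

open SingChain in
-- A finite subset of a T1 space is discrete, so its Euler characteristic counts its points.
theorem DeformationRetraction.hasEuler {X : Type} [TopologicalSpace X] [T1Space X] {W D : Set X}
    (r : DeformationRetraction W D) (hD : D.Finite) :
    HasEuler (insideComplex W) D.ncard := by
  have : Finite D := hD
  have := (hasEuler_of_finite_discrete D).of_homotopyEquiv r.homotopyEquiv
  exact (this.of_iso (singularIso W)).of_iso (complexIsoInside W)

open SingChain in
theorem hasEuler_empty {X : Type} [TopologicalSpace X] [T1Space X] :
    HasEuler (insideComplex (∅ : Set X)) 0 := by
  have r : DeformationRetraction (∅ : Set X) ∅ :=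
    { toFun := fun p => p.2
      continuous_toFun := by fun_prop
      mem := fun p => p.2.2
      apply_zero := fun _ => rfl
      apply_one := fun w => w.2
      subset := subset_rfl
      apply_one_of_mem := fun _ _ => rfl }
  simpa using r.hasEuler finite_empty

open SingChain in
/-- The inclusion-exclusion formula for the Euler characteristic. -/
theorem hasEuler_biUnion {X ι : Type} [TopologicalSpace X] [T1Space X] [DecidableEq ι]
    (s : Finset ι) (U : ι → Set X) (hU : ∀ i, IsOpen (U i)) (c : Finset ι → ℤ)
    (hc : ∀ t ⊆ s, t.Nonempty → HasEuler (insideComplex (⋂ i ∈ t, U i)) (c t)) :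
    HasEuler (insideComplex (⋃ i ∈ s, U i))
      (∑ t ∈ s.powerset with t.Nonempty, (-1) ^ (t.card + 1) * c t) := by
  induction s using Finset.induction_on generalizing U c with
  | empty =>
    have : (Finset.powerset (∅ : Finset ι)).filter Finset.Nonempty = ∅ := by
      ext t
      simp +contextual [Finset.nonempty_iff_ne_empty]
    rw [this]
    simpa using hasEuler_empty
  | insert a s ha ih =>
    have h1 := ih U hU c fun t ht => hc t (ht.trans (Finset.subset_insert a s))
    -- The intersection of `U a` with the union of the others is itself a union of `s` open sets,
    -- whose intersections are those indexed by `insert a t`.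
    have h2 := ih (fun i => U a ∩ U i) (fun i => (hU a).inter (hU i)) (fun t => c (insert a t))
      fun t ht hne => by
        have := hc (insert a t) (Finset.insert_subset_insert a ht) (Finset.insert_nonempty a t)
        rw [Finset.set_biInter_insert] at this
        have e : (⋂ i ∈ t, U a ∩ U i) = U a ∩ ⋂ i ∈ t, U i := by
          ext x
          obtain ⟨j, hj⟩ := hne
          simp only [mem_iInter, mem_inter_iff]
          exact ⟨fun h => ⟨(h j hj).1, fun i hi => (h i hi).2⟩, fun h i hi => ⟨h.1, h.2 i hi⟩⟩
        rwa [e]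
    have h3 := hc {a} (by simp) (by simp)
    rw [Finset.set_biInter_singleton] at h3
    have e2 : (⋃ i ∈ s, U a ∩ U i) = U a ∩ ⋃ i ∈ s, U i := by
      simp only [inter_iUnion]
    rw [e2] at h2
    have := hasEuler_union (hU a)
      (isOpen_iUnion fun i => isOpen_iUnion fun (_ : i ∈ s) => hU i) h3 h1 h2
    rw [Finset.set_biUnion_insert]
    convert this using 1
    -- The nonempty subsets of `insert a s` are those of `s`, the singleton `{a}`, and `insert a t`
    -- for nonempty `t ⊆ s`; the last have the opposite sign and match the subtracted term.
    have hsplit : ∀ f : Finset ι → ℤ, ∑ t ∈ s.powerset, f t =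
        f ∅ + ∑ t ∈ s.powerset with t.Nonempty, f t := by
      intro f
      rw [← Finset.sum_filter_add_sum_filter_not _ Finset.Nonempty, add_comm]
      congr 1
      have : s.powerset.filter (fun t => ¬ t.Nonempty) = {∅} := by
        ext t
        simp +contextual [Finset.not_nonempty_iff_eq_empty]
      rw [this, Finset.sum_singleton]
    rw [Finset.sum_filter, Finset.sum_powerset_insert ha]
    rw [← Finset.sum_filter, hsplit]
    simp only [Finset.insert_nonempty, if_true]
    have hcard : ∀ t ∈ s.powerset.filter Finset.Nonempty,
        (-1 : ℤ) ^ ((insert a t).card + 1) * c (insert a t) =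
          -((-1) ^ (t.card + 1) * c (insert a t)) := by
      intro t ht
      have : a ∉ t := fun h => ha (Finset.mem_powerset.mp (Finset.mem_filter.mp ht).1 h)
      rw [Finset.card_insert_of_notMem this]
      ring
    rw [Finset.sum_congr rfl hcard, Finset.sum_neg_distrib]
    simp
    ring

open SingChain in
/-- The Euler characteristic of a space with a finite open cover, the intersections of whose members
deformation retract to finite sets. -/
theorem hasEuler_of_cover {X ι : Type} [TopologicalSpace X] [T1Space X] [DecidableEq ι]
    (s : Finset ι) (U : ι → Set X) (hU : ∀ i, IsOpen (U i)) (hcover : ⋃ i ∈ s, U i = univ)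
    (D : Finset ι → Set X) (hD : ∀ t ⊆ s, t.Nonempty → (D t).Finite)
    (r : ∀ t ⊆ s, t.Nonempty → Nonempty (DeformationRetraction (⋂ i ∈ t, U i) (D t))) :
    HasEuler (singularComplex X)
      (∑ t ∈ s.powerset with t.Nonempty, (-1) ^ (t.card + 1) * ((D t).ncard : ℤ)) := by
  have := hasEuler_biUnion s U hU (fun t => ((D t).ncard : ℤ))
    fun t ht hne => (r t ht hne).some.hasEuler (hD t ht hne)
  rw [hcover] at this
  have h' := (this.of_iso (complexIsoInside univ).symm).of_iso (singularIso _).symm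
  exact h'.of_homotopyEquiv (Homeomorph.Set.univ X).toHomotopyEquiv

end

/-! ### Coverings of polyhedra -/

namespace Geometry.SimplicialComplex

variable {E : Type} [NormedAddCommGroup E] [NormedSpace ℝ E] (K : SimplicialComplex ℝ E)

/-- The points all of whose simplices have the vertex `v`. -/
def openStar (v : E) : Set E := {x | ∀ t ∈ K.faces, x ∈ convexHull ℝ (t : Set E) → v ∈ t}

variable {K}

/-- The complement is a finite union of closed simplices. Points outside the polyhedron belong to
every star vacuously, which does no harm since stars are only pulled back to the polyhedron. -/
theorem isOpen_openStar (hK : K.faces.Finite) (v : E) : IsOpen (K.openStar v) := by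
  have : K.openStar v =
      (⋃ t ∈ {t ∈ K.faces | v ∉ t}, convexHull ℝ (t : Set E))ᶜ := by
    ext x
    simp only [openStar, mem_ofPred_eq, compl_iUnion, mem_iInter, mem_compl_iff]
    exact ⟨fun h t ht hx => ht.2 (h t ht.1 hx), fun h t ht hx => by_contra fun hv => h t ⟨ht, hv⟩ hx⟩
  rw [this, isOpen_compl_iff]
  exact (hK.subset fun t ht => ht.1).isClosed_biUnion fun t _ =>
    (t.finite_toSet.isCompact_convexHull ℝ).isClosed

/-- A face of least cardinality containing `x` meets every other face containing `x` in a face that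
contains `x`. By minimality it is contained in that other face, so any of its vertices will do. -/
theorem exists_mem_openStar {x : E} (hx : x ∈ K.space) :
    ∃ t ∈ K.faces, ∃ v ∈ t, x ∈ K.openStar v := by
  classical
  obtain ⟨t₀, ht₀, hx₀⟩ := mem_space_iff.mp hx
  have hex : ∃ n, ∃ t ∈ K.faces, x ∈ convexHull ℝ (t : Set E) ∧ t.card = n :=
    ⟨_, t₀, ht₀, hx₀, rfl⟩
  obtain ⟨t, ht, hxt, hn⟩ := Nat.find_spec hex
  obtain ⟨v, hv⟩ := (K.isRelLowerSet_faces ht).1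
  refine ⟨t, ht, v, hv, fun t' ht' hxt' => ?_⟩
  have hmem : x ∈ convexHull ℝ ((t ∩ t' : Finset E) : Set E) := by
    rw [Finset.coe_inter]
    exact K.inter_subset_convexHull ht ht' ⟨hxt, hxt'⟩
  have hne : (t ∩ t').Nonempty := by
    have := convexHull_nonempty_iff.mp ⟨x, hmem⟩
    exact_mod_cast this
  have hface : t ∩ t' ∈ K.faces := (K.isRelLowerSet_faces ht).2 Finset.inter_subset_left hne
  have hle : t.card ≤ (t ∩ t').card := by
    rw [hn]
    exact Nat.find_min' hex ⟨_, hface, hmem, rfl⟩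
  have := Finset.eq_of_subset_of_card_le Finset.inter_subset_left hle
  rw [← this] at hv
  exact (Finset.mem_inter.mp hv).2

/-- Membership of the point with the weights `w` in another face. -/
theorem mem_of_weight_pos {t t' : Finset E} (ht : t ∈ K.faces) (ht' : t' ∈ K.faces) {w : E → ℝ}
    (h0 : ∀ y ∈ t, 0 ≤ w y) (h1 : ∑ y ∈ t, w y = 1)
    (hy : ∑ y ∈ t, w y • y ∈ convexHull ℝ (t' : Set E)) {v : E} (hv : v ∈ t) (hw : 0 < w v) :
    v ∈ t' := by
  classical
  by_contra hvt
  have hmem : ∑ y ∈ t, w y • y ∈ convexHull ℝ ((t ∩ t' : Finset E) : Set E) := by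
    rw [Finset.coe_inter]
    exact K.inter_subset_convexHull ht ht' ⟨Finset.mem_convexHull'.mpr ⟨w, h0, h1, rfl⟩, hy⟩
  obtain ⟨u, hu0, hu1, hu⟩ := Finset.mem_convexHull'.mp hmem
  -- Two weight functions on `t` give the same point, and the second vanishes at `v`; affine
  -- independence forces `w v = 0`.
  have hind := affineIndependent_iff.mp (K.indep ht) Finset.univ
    (fun y => w y - if (y : E) ∈ t' then u y else 0)
  have e1 : ∑ y ∈ t, (if y ∈ t' then u y else 0) = 1 := by
    rw [← Finset.sum_filter, ← hu1, Finset.filter_mem_eq_inter]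
  have e2 : ∑ y ∈ t, (if y ∈ t' then u y else 0) • y = ∑ y ∈ t, w y • y := by
    rw [← hu, ← Finset.filter_mem_eq_inter, Finset.sum_filter]
    exact Finset.sum_congr rfl fun y _ => by split_ifs <;> simp
  have := hind (by
      rw [Finset.univ_eq_attach, Finset.sum_attach t fun y => w y - if y ∈ t' then u y else 0,
        Finset.sum_sub_distrib, h1, e1, sub_self]) (by
      rw [Finset.univ_eq_attach,
        Finset.sum_attach t fun y => (w y - if y ∈ t' then u y else 0) • y]
      simp only [sub_smul]
      rw [Finset.sum_sub_distrib, e2, sub_self]) ⟨v, hv⟩ (Finset.mem_univ _)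
  simp [hvt] at this
  exact hw.ne' this

/-- The barycenter of a face. -/
noncomputable def faceCenter (s : Finset E) : E := ∑ y ∈ s, (s.card : ℝ)⁻¹ • y

/-- The intersections of open stars are star-convex in the polyhedron. -/
theorem segment_mem_openStar {s : Finset E} (hs : s ∈ K.faces) {x : E} (hx : x ∈ K.space)
    (hxs : ∀ v ∈ s, x ∈ K.openStar v) {a b : ℝ} (ha : 0 ≤ a) (hb : 0 ≤ b) (hab : a + b = 1) :
    a • x + b • faceCenter s ∈ K.space ∧ ∀ v ∈ s, a • x + b • faceCenter s ∈ K.openStar v := by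
  classical
  obtain ⟨t, ht, hxt⟩ := mem_space_iff.mp hx
  have hst : s ⊆ t := fun v hv => hxs v hv t ht hxt
  obtain ⟨w, hw0, hw1, hw⟩ := Finset.mem_convexHull'.mp hxt
  have hscard : (0 : ℝ) < s.card := by
    exact_mod_cast (K.isRelLowerSet_faces hs).1.card_pos
  set u : E → ℝ := fun y => a * w y + b * if y ∈ s then (s.card : ℝ)⁻¹ else 0 with hu
  have hu0 : ∀ y ∈ t, 0 ≤ u y := fun y hy => by
    have := hw0 y hy
    have h2 : (0 : ℝ) ≤ if y ∈ s then (s.card : ℝ)⁻¹ else 0 := by split_ifs <;> positivity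
    positivity
  have hu1 : ∑ y ∈ t, u y = 1 := by
    rw [Finset.sum_add_distrib, ← Finset.mul_sum, ← Finset.mul_sum, hw1, ← Finset.sum_filter,
      Finset.filter_mem_eq_inter, Finset.inter_eq_right.mpr hst, Finset.sum_const, nsmul_eq_mul,
      mul_inv_cancel₀ hscard.ne', mul_one, mul_one, hab]
  have hus : ∑ y ∈ t, u y • y = a • x + b • faceCenter s := by
    simp only [hu, add_smul, mul_smul]
    rw [Finset.sum_add_distrib, ← Finset.smul_sum, ← Finset.smul_sum, hw, faceCenter]
    congr 2
    rw [← Finset.inter_eq_right.mpr hst, ← Finset.filter_mem_eq_inter, Finset.sum_filter]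
    rw [Finset.filter_mem_eq_inter, Finset.inter_eq_right.mpr hst]
    exact Finset.sum_congr rfl fun y _ => by split_ifs <;> simp
  have hyt : a • x + b • faceCenter s ∈ convexHull ℝ (t : Set E) :=
    Finset.mem_convexHull'.mpr ⟨u, hu0, hu1, hus⟩
  refine ⟨mem_space_iff.mpr ⟨t, ht, hyt⟩, fun v hv t' ht' hy => ?_⟩
  -- If `b` is positive, every vertex of `s` has positive weight in the new point; if `b = 0`, the
  -- point is `x`.
  rcases hb.eq_or_lt with rfl | hb
  · obtain rfl : a = 1 := by simpa using hab
    exact hxs v hv t' ht' (by simpa using hy)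
  · rw [← hus] at hy
    refine mem_of_weight_pos ht ht' hu0 hu1 hy (hst hv) ?_
    simp only [hu, hv, if_true]
    have := hw0 v (hst hv)
    positivity

theorem faceCenter_mem {s : Finset E} (hs : s ∈ K.faces) :
    faceCenter s ∈ K.space ∧ ∀ v ∈ s, faceCenter s ∈ K.openStar v := by
  have hscard : (0 : ℝ) < s.card := by
    exact_mod_cast (K.isRelLowerSet_faces hs).1.card_pos
  have h1 : ∑ y ∈ s, (s.card : ℝ)⁻¹ = 1 := by
    rw [Finset.sum_const, nsmul_eq_mul, mul_inv_cancel₀ hscard.ne']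
  refine ⟨mem_space_iff.mpr ⟨s, hs, Finset.mem_convexHull'.mpr ⟨fun _ => (s.card : ℝ)⁻¹,
    fun y _ => by positivity, h1, rfl⟩⟩, fun v hv t' ht' hy => ?_⟩
  exact mem_of_weight_pos hs ht' (w := fun _ => (s.card : ℝ)⁻¹) (fun y _ => by positivity) h1 hy hv
    (by positivity)

/-- The nerve of the cover by open stars has no simplices other than the faces of `K`. -/
theorem mem_faces_of_mem_openStar {s : Finset E} (hs : s.Nonempty) {x : E} (hx : x ∈ K.space)
    (hxs : ∀ v ∈ s, x ∈ K.openStar v) : s ∈ K.faces := by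
  obtain ⟨t, ht, hxt⟩ := mem_space_iff.mp hx
  exact (K.isRelLowerSet_faces ht).2 (fun v hv => hxs v hv t ht hxt) hs

end Geometry.SimplicialComplex

/-- The deformation retraction of the empty set. -/
def DeformationRetraction.ofEmpty {X : Type} [TopologicalSpace X] {W : Set X} (hW : W = ∅) :
    DeformationRetraction W ∅ where
  toFun p := p.2
  continuous_toFun := by fun_prop
  mem p := p.2.2
  apply_zero _ := rfl
  apply_one w := (hW.subset w.2).elim
  subset := empty_subset _
  apply_one_of_mem _ h := h.elim

open Geometry.SimplicialComplex in
/-- In a covering space of a polyhedron, the preimage of an intersection of open stars retracts to a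
fibre. -/
theorem nonempty_deformationRetraction_openStar {E X : Type} [NormedAddCommGroup E]
    [NormedSpace ℝ E] [TopologicalSpace X] {K : Geometry.SimplicialComplex ℝ E} {M : Set E}
    (hM : K.space = M) {p : X → M} (hp : IsCoveringMap p) {s : Finset E} (hs : s ∈ K.faces) :
    Nonempty (DeformationRetraction (⋂ v ∈ s, p ⁻¹' (Subtype.val ⁻¹' K.openStar v))
      (p ⁻¹' {⟨faceCenter s, hM ▸ (faceCenter_mem hs).1⟩})) := by
  set W : Set X := ⋂ v ∈ s, p ⁻¹' (Subtype.val ⁻¹' K.openStar v) with hW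
  set b : M := ⟨faceCenter s, hM ▸ (faceCenter_mem hs).1⟩ with hb
  have hmemW : ∀ x, x ∈ W ↔ ∀ v ∈ s, (p x : E) ∈ K.openStar v := fun x => by
    simp [hW]
  have hseg : ∀ q : unitInterval × W,
      (1 - (q.1 : ℝ)) • (p q.2 : E) + (q.1 : ℝ) • faceCenter s ∈ K.space ∧
      ∀ v ∈ s, (1 - (q.1 : ℝ)) • (p q.2 : E) + (q.1 : ℝ) • faceCenter s ∈ K.openStar v := fun q =>
    segment_mem_openStar hs (hM ▸ (p q.2).2) ((hmemW q.2).mp q.2.2)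
      (sub_nonneg.mpr q.1.2.2) q.1.2.1 (by ring)
  have hpc := hp.continuous
  -- The straight-line contraction to the barycenter takes place in the base and is then lifted,
  -- starting at the inclusion of `W`.
  let H : C(unitInterval × W, M) :=
    ⟨fun q => ⟨(1 - (q.1 : ℝ)) • (p q.2 : E) + (q.1 : ℝ) • faceCenter s, hM ▸ (hseg q).1⟩, by
      fun_prop⟩
  let f : C(W, X) := ⟨Subtype.val, continuous_subtype_val⟩
  have H0 : ∀ w, H (0, w) = p (f w) := fun w => Subtype.ext (by simp [H, f])
  have hlift : ∀ q, p (hp.liftHomotopy H f H0 q) = H q :=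
    fun q => congrFun (hp.liftHomotopy_lifts H f H0) q
  refine ⟨{
    toFun := hp.liftHomotopy H f H0
    continuous_toFun := (hp.liftHomotopy H f H0).continuous
    mem := fun q => (hmemW _).mpr fun v hv => by
      rw [hlift]
      exact (hseg q).2 v hv
    apply_zero := fun w => hp.liftHomotopy_zero H f H0 w
    apply_one := fun w => by
      rw [mem_preimage, hlift, mem_singleton_iff]
      exact Subtype.ext (by simp [H, hb])
    subset := fun x hx => (hmemW x).mpr fun v hv => by
      rw [mem_preimage, mem_singleton_iff] at hx
      rw [hx]
      exact (faceCenter_mem hs).2 v hv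
    apply_one_of_mem := fun w hw => ?_ }⟩
  rw [mem_preimage, mem_singleton_iff] at hw
  -- Over the barycenter the contraction is constant, and so is its lift: the fibre stays fixed.
  have hconst := hp.liftPath_const (x := b) (e := (w : X)) hw.symm
  have : hp.liftHomotopy H f H0 (1, w) = ContinuousMap.const unitInterval (w : X) 1 := by
    rw [← hconst, IsCoveringMap.liftHomotopy_apply]
    congr 2
    ext1 t
    refine Subtype.ext ?_
    simp [H, hw, hb, ← add_smul]
  exact this

open Geometry.SimplicialComplex Classical in
/-- The Euler characteristic of a finite covering space of a polyhedron. -/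
theorem hasEuler_covering {E X : Type} [NormedAddCommGroup E]
    [NormedSpace ℝ E] [TopologicalSpace X] [T1Space X] {K : Geometry.SimplicialComplex ℝ E}
    {M : Set E} (hK : K.faces.Finite) (hM : K.space = M) {p : X → M} (hp : IsCoveringMap p)
    {d : ℕ} (hd0 : 0 < d) (hd : ∀ y, (p ⁻¹' {y}).ncard = d) :
    HasEuler (singularComplex X) (d * ∑ t ∈ (hK.toFinset.biUnion id).powerset with t ∈ K.faces,
      (-1) ^ (t.card + 1)) := by
  have := hasEuler_of_cover (X := X) (hK.toFinset.biUnion id)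
    (fun v => p ⁻¹' (Subtype.val ⁻¹' K.openStar v))
    (fun v => ((isOpen_openStar hK v).preimage continuous_subtype_val).preimage
      hp.continuous) ?_
    (fun s => if hs : s ∈ K.faces then
      p ⁻¹' {⟨faceCenter s, hM ▸ (faceCenter_mem hs).1⟩} else ∅) ?_ ?_
  · convert this using 1
    rw [Finset.mul_sum, Finset.sum_filter, Finset.sum_filter]
    refine Finset.sum_congr rfl fun t _ => ?_
    by_cases ht : t ∈ K.faces
    · have hne := (K.isRelLowerSet_faces ht).1
      simp only [ht, hne, if_true, dif_pos, hd]
      ring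
    · simp [ht]
  · refine eq_univ_of_forall fun x => ?_
    obtain ⟨t, ht, v, hv, hx⟩ := exists_mem_openStar (K := K) (x := p x) (hM ▸ (p x).2)
    simp only [mem_iUnion]
    exact ⟨v, Finset.mem_biUnion.mpr ⟨t, by simpa using ht, hv⟩, hx⟩
  · intro t _ _
    by_cases ht : t ∈ K.faces
    · simp only [ht, dif_pos]
      -- An infinite set has `ncard` equal to `0`, so a positive degree makes the fibre finite.
      refine finite_of_ncard_pos ?_
      rw [hd]
      exact hd0
    · simp [ht]
  · intro t _ hne
    by_cases ht : t ∈ K.faces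
    · simp only [ht, dif_pos]
      exact nonempty_deformationRetraction_openStar hM hp ht
    · simp only [ht, dif_neg, not_false_eq_true]
      refine ⟨DeformationRetraction.ofEmpty ?_⟩
      refine eq_empty_of_forall_notMem fun x hx => ht ?_
      refine mem_faces_of_mem_openStar hne (x := p x) (hM ▸ (p x).2) fun v hv => ?_
      simp only [mem_iInter] at hx
      exact hx v hv

/-- The Euler characteristic is multiplicative under finite coverings of compact polyhedra. -/
theorem exists_hasEuler_covering {N : ℕ} {M : Set (Fin N → ℝ)} (hM : IsCompactPolyhedron M)
    {X : Type} [TopologicalSpace X] [T1Space X] {p : X → M} (hp : IsCoveringMap p)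
    {d : ℕ} (hd0 : 0 < d) (hd : ∀ y, (p ⁻¹' {y}).ncard = d) :
    HasEuler (singularComplex X) (d * eulerCharacteristic M) := by
  obtain ⟨K, hK, hKM⟩ := hM
  have h1 := hasEuler_covering hK hKM hp hd0 hd
  have hc : IsCompact M := by
    rw [← hKM, Geometry.SimplicialComplex.space]
    exact hK.isCompact_biUnion fun t _ => t.finite_toSet.isCompact_convexHull ℝ
  have : CompactSpace M := isCompact_iff_compactSpace.mp hc
  -- The identity, as a covering of degree `1`, expresses the Euler characteristic of `M` by the
  -- same sum over faces.
  have h2 := hasEuler_covering hK hKM (p := id) (d := 1)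
    (isLocalHomeomorph_iff_isCoveringMap.mp (Homeomorph.refl M).isLocalHomeomorph)
    one_pos (by simp)
  have : eulerCharacteristic M = _ := h2.2.2
  rw [this]
  simpa using h1

/-! ### Alternating sums over flags -/

section Flags

variable {V : Type} [Fintype V] [DecidableEq V]

/-- A flag of nonempty sets. -/
def IsFlag (C : Finset (Finset V)) : Prop :=
  IsChain (· ⊆ ·) (C : Set (Finset V)) ∧ ∀ A ∈ C, A.Nonempty

omit [Fintype V] in
theorem IsFlag.sup_mem {C : Finset (Finset V)} (hC : IsFlag C) (hne : C.Nonempty) :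
    C.sup id ∈ C := by
  obtain ⟨A, hA, hmax⟩ := C.exists_max_image Finset.card hne
  have : C.sup id = A := by
    refine le_antisymm (Finset.sup_le fun B hB => ?_) (Finset.le_sup (f := id) hA)
    rcases hC.1.total hA hB with h | h
    · exact (Finset.eq_of_subset_of_card_le h (hmax B hB)).ge
    · exact h
  rwa [this]

omit [Fintype V] [DecidableEq V] in
theorem IsFlag.eq_of_card_eq {C : Finset (Finset V)} (hC : IsFlag C) {A B : Finset V} (hA : A ∈ C)
    (hB : B ∈ C) (h : A.card = B.card) : A = B := by
  rcases hC.1.total hA hB with h' | h'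
  · exact Finset.eq_of_subset_of_card_le h' h.ge
  · exact (Finset.eq_of_subset_of_card_le h' h.le).symm

open Classical in
/-- The alternating number of flags with union `A`, all of whose members satisfy `p`. -/
noncomputable def flagSum (p : Finset V → Prop) (A : Finset V) : ℤ :=
  ∑ C : Finset (Finset V) with IsFlag C ∧ (∀ B ∈ C, p B) ∧ C.sup id = A, (-1) ^ C.card

theorem flagSum_empty (p : Finset V → Prop) : flagSum p ∅ = 1 := by
  classical
  have : (Finset.univ.filter fun C : Finset (Finset V) =>
      IsFlag C ∧ (∀ B ∈ C, p B) ∧ C.sup id = ∅) = {∅} := by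
    ext C
    simp only [Finset.mem_filter, Finset.mem_univ, true_and, Finset.mem_singleton]
    constructor
    · rintro ⟨hC, -, h⟩
      by_contra hne
      have := hC.2 _ (hC.sup_mem (Finset.nonempty_iff_ne_empty.mpr hne))
      rw [h] at this
      exact Finset.not_nonempty_empty this
    · rintro rfl
      refine ⟨⟨by simp, by simp⟩, by simp, rfl⟩
  rw [flagSum, this]
  simp

open Classical in
-- Adding or removing `A` is a sign-reversing involution on the flags with union inside `A`. The
-- identity is the recursion of the Möbius function of the poset of sets satisfying `p`, which
-- `flagSum p` therefore computes.
theorem sum_flagSum {p : Finset V → Prop} (hp : p ∅) {A : Finset V} (hA : A.Nonempty) (hpA : p A) :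
    ∑ B ∈ A.powerset with p B, flagSum p B = 0 := by
  set F := Finset.univ.filter fun C : Finset (Finset V) =>
    IsFlag C ∧ (∀ B ∈ C, p B) ∧ C.sup id ⊆ A with hF
  have h1 : ∑ C ∈ F, (-1 : ℤ) ^ C.card = 0 := by
    have hsup : ∀ C ∈ F, ∀ B ∈ C, B ⊆ A := fun C hC B hB =>
      (Finset.le_sup (f := id) hB).trans (Finset.mem_filter.mp hC).2.2.2
    refine Finset.sum_involution (fun C _ => if A ∈ C then C.erase A else insert A C) ?_ ?_ ?_ ?_
    · intro C hC
      by_cases h : A ∈ C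
      · simp only [h, if_true]
        rw [← Finset.card_erase_add_one h, pow_succ]
        ring
      · simp only [h, if_false]
        rw [Finset.card_insert_of_notMem h, pow_succ]
        ring
    · intro C hC _
      by_cases h : A ∈ C
      · simp only [h, if_true]
        intro e
        rw [← e] at h
        exact Finset.notMem_erase A C h
      · simp only [h, if_false]
        intro e
        exact h (e ▸ Finset.mem_insert_self A C)
    · intro C hC
      have hs := hsup C hC
      obtain ⟨-, h1, h2, h3⟩ := Finset.mem_filter.mp hC
      by_cases h : A ∈ C
      · simp only [h, if_true]
        refine Finset.mem_filter.mpr ⟨Finset.mem_univ _, ⟨?_, ?_⟩, ?_, ?_⟩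
        · exact h1.1.mono (by simp)
        · exact fun B hB => h1.2 B (Finset.mem_of_mem_erase hB)
        · exact fun B hB => h2 B (Finset.mem_of_mem_erase hB)
        · exact (Finset.sup_mono (Finset.erase_subset A C)).trans h3
      · simp only [h, if_false]
        refine Finset.mem_filter.mpr ⟨Finset.mem_univ _, ⟨?_, ?_⟩, ?_, ?_⟩
        · rw [Finset.coe_insert]
          exact h1.1.insert fun B hB _ => Or.inr (hs B hB)
        · exact fun B hB => (Finset.mem_insert.mp hB).elim (fun e => e ▸ hA) (h1.2 B)
        · exact fun B hB => (Finset.mem_insert.mp hB).elim (fun e => e ▸ hpA) (h2 B)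
        · rw [Finset.sup_insert]
          exact sup_le le_rfl h3
    · intro C hC
      by_cases h : A ∈ C
      · simp [h]
      · simp [h]
  rw [← h1, ← Finset.sum_fiberwise_of_maps_to (s := F) (t := A.powerset.filter p)
    (g := fun C => C.sup id)]
  · refine Finset.sum_congr rfl fun B hB => ?_
    rw [flagSum]
    refine Finset.sum_congr ?_ fun _ _ => rfl
    ext C
    have := Finset.mem_powerset.mp (Finset.mem_filter.mp hB).1
    simp only [hF, Finset.mem_filter, Finset.mem_univ, true_and]
    exact ⟨fun h => ⟨⟨h.1, h.2.1, h.2.2.le.trans this⟩, h.2.2⟩, fun h => ⟨h.1.1, h.1.2.1, h.2⟩⟩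
  · intro C hC
    obtain ⟨-, h1, h2, h3⟩ := Finset.mem_filter.mp hC
    refine Finset.mem_filter.mpr ⟨Finset.mem_powerset.mpr h3, ?_⟩
    rcases C.eq_empty_or_nonempty with rfl | hne
    · exact hp
    · exact h2 _ (h1.sup_mem hne)

open Classical in
/-- Removing a minimal set `O` from `A` changes the sign of the alternating number of flags. -/
theorem flagSum_eq_neg {p : Finset V → Prop} (hp : p ∅) {O : Finset V} (hO : O.Nonempty)
    (hmin : ∀ B, p B → O ⊆ B ∨ Disjoint O B) (hsdiff : ∀ B, p B → p (B \ O))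
    (hunion : ∀ B, p B → p (B ∪ O)) (A : Finset V) (hA : p A) (hOA : O ⊆ A) :
    flagSum p A = -flagSum p (A \ O) := by
  induction A using Finset.strongInduction with | _ A ih =>
  have h0 := sum_flagSum hp (hO.mono hOA) hA
  -- The sets below `A` come in pairs `B`, `B ∪ O`. By induction each pair cancels, except for `B =
  -- A \ O`, where `B ∪ O = A`.
  have hsplit : A.powerset.filter p = (A \ O).powerset.filter p ∪
      ((A \ O).powerset.filter p).image (· ∪ O) := by
    ext B
    simp only [Finset.mem_union, Finset.mem_filter, Finset.mem_powerset, Finset.mem_image]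
    constructor
    · rintro ⟨h1, h2⟩
      rcases hmin B h2 with h | h
      · exact Or.inr ⟨B \ O, ⟨Finset.sdiff_subset_sdiff h1 subset_rfl, hsdiff B h2⟩,
          Finset.sdiff_union_of_subset h⟩
      · exact Or.inl ⟨Finset.subset_sdiff.mpr ⟨h1, h.symm⟩, h2⟩
    · rintro (⟨h1, h2⟩ | ⟨B, ⟨h1, h2⟩, rfl⟩)
      · exact ⟨h1.trans Finset.sdiff_subset, h2⟩
      · exact ⟨Finset.union_subset (h1.trans Finset.sdiff_subset) hOA, hunion B h2⟩
  have hdisj : Disjoint ((A \ O).powerset.filter p)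
      (((A \ O).powerset.filter p).image (· ∪ O)) := by
    rw [Finset.disjoint_left]
    intro B hB hB'
    obtain ⟨B', -, rfl⟩ := Finset.mem_image.mp hB'
    have := (Finset.mem_powerset.mp (Finset.mem_filter.mp hB).1)
    obtain ⟨x, hx⟩ := hO
    exact (Finset.mem_sdiff.mp (this (Finset.mem_union_right _ hx))).2 hx
  have hdO : ∀ B ∈ (A \ O).powerset.filter p, Disjoint B O := fun B hB =>
    (Finset.subset_sdiff.mp (Finset.mem_powerset.mp (Finset.mem_filter.mp hB).1)).2
  rw [hsplit, Finset.sum_union hdisj, Finset.sum_image] at h0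
  · rw [← Finset.sum_add_distrib] at h0
    have hmem : A \ O ∈ (A \ O).powerset.filter p := by simp [hsdiff A hA]
    rw [Finset.sum_eq_single_of_mem _ hmem] at h0
    · rw [Finset.sdiff_union_of_subset hOA] at h0
      linarith
    · intro B hB hne
      have hBs := Finset.mem_powerset.mp (Finset.mem_filter.mp hB).1
      have hlt : B ∪ O ⊂ A := by
        refine Finset.ssubset_iff_subset_ne.mpr
          ⟨Finset.union_subset (hBs.trans Finset.sdiff_subset) hOA, fun e => hne ?_⟩
        rw [← e, Finset.union_sdiff_right, Finset.sdiff_eq_self_of_disjoint (hdO B hB)]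
      have := ih _ hlt (hunion B (Finset.mem_filter.mp hB).2) Finset.subset_union_right
      rw [Finset.union_sdiff_right, Finset.sdiff_eq_self_of_disjoint (hdO B hB)] at this
      rw [this]
      ring
  · intro B hB B' hB' e
    have e' := congrArg (· \ O) e
    simpa only [Finset.union_sdiff_right, Finset.sdiff_eq_self_of_disjoint (hdO B hB),
      Finset.sdiff_eq_self_of_disjoint (hdO B' hB')] using e'

open scoped Pointwise in
/-- The alternating number of flags of sets that are invariant under a permutation is `1` or `-1`. -/
theorem natAbs_flagSum_smul (g : Equiv.Perm V) (A : Finset V) (hA : g • A = A) :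
    (flagSum (fun B => g • B = B) A).natAbs = 1 := by
  classical
  induction A using Finset.strongInduction with | _ A ih =>
  rcases A.eq_empty_or_nonempty with rfl | ⟨a, ha⟩
  · rw [flagSum_empty]; rfl
  have hmem : ∀ B : Finset V, g • B = B → ∀ x, g x ∈ B ↔ x ∈ B := fun B hB x => by
    rw [← Finset.smul_mem_smul_finset_iff g (s := B) (b := x), hB]
    rfl
  have hinv : ∀ B : Finset V, (∀ x, g x ∈ B ↔ x ∈ B) → g • B = B := fun B hB => by
    ext x
    rw [← Finset.inv_smul_mem_iff, ← hB]
    simp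
  -- The cycle of `g` through `a` is a minimal nonempty invariant set. Removing cycles one at a time
  -- only changes the sign.
  set O : Finset V := Finset.univ.filter fun x => g.SameCycle a x with hO
  have hOmem : ∀ x, g x ∈ O ↔ x ∈ O := fun x => by simp [hO]
  have hcyc : ∀ B : Finset V, g • B = B → ∀ x y, g.SameCycle x y → (y ∈ B ↔ x ∈ B) := by
    rintro B hB x y ⟨i, rfl⟩
    have hz : ∀ n : ℕ, ∀ x, (g ^ n) x ∈ B ↔ x ∈ B := fun n => by
      induction n with
      | zero => simp
      | succ n ih => intro x; rw [pow_succ', Equiv.Perm.mul_apply, hmem B hB, ih]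
    obtain ⟨n, rfl | rfl⟩ := i.eq_nat_or_neg
    · exact_mod_cast hz n x
    · rw [← hz n ((g ^ (-(n : ℤ))) x)]
      simp
  have key := flagSum_eq_neg (p := fun B => g • B = B) (by simp) (O := O) ⟨a, by simp [hO, Equiv.Perm.SameCycle.refl]⟩
    (fun B hB => by
      by_cases h : a ∈ B
      · exact Or.inl fun x hx => (hcyc B hB a x (Finset.mem_filter.mp hx).2).mpr h
      · refine Or.inr (Finset.disjoint_left.mpr fun x hx hxB => h ?_)
        exact (hcyc B hB a x (Finset.mem_filter.mp hx).2).mp hxB)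
    (fun B hB => hinv _ fun x => by
      rw [Finset.mem_sdiff, Finset.mem_sdiff, hmem B hB, hOmem])
    (fun B hB => hinv _ fun x => by
      rw [Finset.mem_union, Finset.mem_union, hmem B hB, hOmem]) A hA
    (fun x hx => (hcyc A hA a x (Finset.mem_filter.mp hx).2).mpr ha)
  rw [key, Int.natAbs_neg]
  refine ih _ ?_ (hinv _ fun x => by rw [Finset.mem_sdiff, Finset.mem_sdiff, hmem A hA, hOmem])
  exact Finset.sdiff_ssubset (fun x hx => (hcyc A hA a x (Finset.mem_filter.mp hx).2).mpr ha)
    ⟨a, by simp [hO, Equiv.Perm.SameCycle.refl]⟩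

end Flags

/-- Burnside's lemma, for a map whose fibres are orbits and a union of orbits. -/
theorem card_mul_card_image_eq_sum {G Z X : Type} [Group G] [Fintype G] [MulAction G Z]
    [DecidableEq Z] [DecidableEq X] (Ψ : Z → X) (hΨ : ∀ z z', Ψ z = Ψ z' ↔ ∃ g : G, g • z = z')
    (T : Finset Z) (hT : ∀ (g : G), ∀ z ∈ T, g • z ∈ T) :
    Fintype.card G * (T.image Ψ).card = ∑ g : G, (T.filter fun z => g • z = z).card := by
  have h1 : ∑ g : G, (T.filter fun z => g • z = z).card =
      ∑ z ∈ T, (Finset.univ.filter fun g : G => g • z = z).card := by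
    simp only [Finset.card_filter]
    rw [Finset.sum_comm]
  rw [h1, ← Finset.sum_fiberwise_of_maps_to (s := T) (t := T.image Ψ) (g := Ψ)
    fun z hz => Finset.mem_image_of_mem Ψ hz, mul_comm, ← smul_eq_mul, ← Finset.sum_const]
  refine Finset.sum_congr rfl fun x hx => ?_
  obtain ⟨z₀, hz₀, rfl⟩ := Finset.mem_image.mp hx
  -- The stabilizer of `z` has as many elements as the set of group elements taking `z₀` to `z`.
  -- These sets partition the group as `z` runs over the fibre.
  have h2 : ∀ z ∈ T.filter (fun z => Ψ z = Ψ z₀),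
      (Finset.univ.filter fun g : G => g • z = z).card =
      (Finset.univ.filter fun g : G => g • z₀ = z).card := by
    intro z hz
    obtain ⟨h, rfl⟩ := (hΨ _ _).mp (Finset.mem_filter.mp hz).2.symm
    refine Finset.card_bij (fun g _ => g * h) ?_ ?_ ?_
    · intro g hg
      simpa [mul_smul] using hg
    · intro g _ g' _ e
      exact mul_right_cancel e
    · intro g hg
      refine ⟨g * h⁻¹, ?_, by simp⟩
      simpa [← mul_smul] using hg
  rw [Finset.sum_congr rfl h2, ← Finset.card_univ]
  refine Finset.card_eq_sum_card_fiberwise (f := fun g : G => g • z₀) fun g _ => ?_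
  exact Finset.mem_coe.mpr (Finset.mem_filter.mpr ⟨hT g z₀ hz₀, ((hΨ _ _).mpr ⟨g, rfl⟩).symm⟩)

/-! ### The barycentric stratification of the simplex -/

section Simplex

variable {ι κ : Type} [Fintype ι] [DecidableEq ι] [Fintype κ] [DecidableEq κ]

/-- The coordinates in `A` are positive and greater than all the others. -/
def IsTopSet (x : ι → ℝ) (A : Finset ι) : Prop := ∀ a ∈ A, 0 < x a ∧ ∀ b ∉ A, x b < x a

/-- For every `s` in `S`, the greatest `s` coordinates are set apart from the others. -/
def HasGaps (S : Finset ℕ) (x : ι → ℝ) : Prop := ∀ s ∈ S, ∃ A : Finset ι, A.card = s ∧ IsTopSet x A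

/-- The mean of the barycenters of the members of a flag. -/
noncomputable def flagPoint (C : Finset (Finset ι)) : ι → ℝ := fun v =>
  ∑ A ∈ C, if v ∈ A then ((C.card : ℝ) * A.card)⁻¹ else 0

open Classical in
/-- The sets of greatest coordinates with cardinality in `S`. -/
noncomputable def topSets (S : Finset ℕ) (x : ι → ℝ) : Finset (Finset ι) :=
  Finset.univ.filter fun A => A.card ∈ S ∧ IsTopSet x A

/-- The cardinalities of the members of a flag. -/
def flagSizes (C : Finset (Finset ι)) : Finset ℕ := C.image Finset.card

/-- The image of a flag under an embedding. -/
def pushFlag (f : κ ↪ ι) (C : Finset (Finset κ)) : Finset (Finset ι) :=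
  C.map ⟨Finset.map f, Finset.map_injective f⟩

omit [Fintype ι] [DecidableEq ι] in
-- Otherwise some `a ∈ A \ B` and `b ∈ B \ A` would each have a greater coordinate than the other.
-- Hence there is at most one such set of each size.
theorem IsTopSet.subset {x : ι → ℝ} {A B : Finset ι} (hA : IsTopSet x A) (hB : IsTopSet x B)
    (h : A.card ≤ B.card) : A ⊆ B := by
  by_contra hAB
  obtain ⟨a, ha, haB⟩ := Finset.not_subset.mp hAB
  have : ¬ B ⊆ A := fun h' => hAB (Finset.eq_of_subset_of_card_le h' h).ge
  obtain ⟨b, hb, hbA⟩ := Finset.not_subset.mp this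
  exact lt_asymm ((hA a ha).2 b hbA) ((hB b hb).2 a haB)

omit [DecidableEq ι] in
theorem mem_topSets {S : Finset ℕ} {x : ι → ℝ} {A : Finset ι} :
    A ∈ topSets S x ↔ A.card ∈ S ∧ IsTopSet x A := by
  simp [topSets]

omit [DecidableEq ι] in
theorem isFlag_topSets {S : Finset ℕ} (hS : 0 ∉ S) (x : ι → ℝ) : IsFlag (topSets S x) := by
  refine ⟨fun A hA B hB _ => ?_, fun A hA => ?_⟩
  · have hA' := mem_topSets.mp hA
    have hB' := mem_topSets.mp hB
    rcases le_total A.card B.card with h | h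
    · exact Or.inl (hA'.2.subset hB'.2 h)
    · exact Or.inr (hB'.2.subset hA'.2 h)
  · have hA' := mem_topSets.mp hA
    refine Finset.card_pos.mp (Nat.pos_of_ne_zero fun h => hS ?_)
    rw [← h]
    exact hA'.1

omit [DecidableEq ι] in
theorem flagSizes_topSets {S : Finset ℕ} {x : ι → ℝ} (hx : HasGaps S x) :
    flagSizes (topSets S x) = S := by
  ext s
  simp only [flagSizes, Finset.mem_image, mem_topSets]
  constructor
  · rintro ⟨A, h, rfl⟩
    exact h.1
  · intro hs
    obtain ⟨A, rfl, hA⟩ := hx s hs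
    exact ⟨A, ⟨hs, hA⟩, rfl⟩

theorem flagPoint_mem_stdSimplex {C : Finset (Finset ι)} (hC : IsFlag C) (hne : C.Nonempty) :
    flagPoint C ∈ stdSimplex ℝ ι := by
  refine ⟨fun v => Finset.sum_nonneg fun A _ => ?_, ?_⟩
  · split_ifs <;> positivity
  · simp only [flagPoint]
    rw [Finset.sum_comm]
    have : ∀ A ∈ C, ∑ v, (if v ∈ A then ((C.card : ℝ) * A.card)⁻¹ else 0) = (C.card : ℝ)⁻¹ := by
      intro A hA
      have hA0 : (A.card : ℝ) ≠ 0 := by exact_mod_cast (hC.2 A hA).card_pos.ne'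
      rw [← Finset.sum_filter, Finset.sum_const, Finset.filter_mem_eq_inter, Finset.univ_inter,
        nsmul_eq_mul, mul_inv, mul_comm, mul_assoc, inv_mul_cancel₀ hA0, mul_one]
    rw [Finset.sum_congr rfl this, Finset.sum_const, nsmul_eq_mul, mul_inv_cancel₀]
    exact_mod_cast hne.card_pos.ne'

omit [Fintype ι] in
-- For `a ∈ A` and `b ∉ A`, every member of the flag that contains `b` also contains `a`, and `A`
-- itself contains only `a`.
theorem isTop_flagPoint {C : Finset (Finset ι)} (hC : IsFlag C) {A : Finset ι} (hA : A ∈ C) :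
    IsTopSet (flagPoint C) A := by
  have hA0 : (0 : ℝ) < A.card := by exact_mod_cast (hC.2 A hA).card_pos
  have hC0 : (0 : ℝ) < C.card := by exact_mod_cast Finset.card_pos.mpr ⟨A, hA⟩
  intro a ha
  constructor
  · refine lt_of_lt_of_le ?_ (Finset.single_le_sum
      (f := fun B : Finset ι => if a ∈ B then ((C.card : ℝ) * B.card)⁻¹ else 0) ?_ hA)
    · simp only [ha, if_true]
      positivity
    · intro B _
      split_ifs <;> positivity
  · intro b hb
    refine Finset.sum_lt_sum (fun B hB => ?_) ⟨A, hA, ?_⟩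
    · by_cases hbB : b ∈ B
      · have : a ∈ B := by
          rcases hC.1.total hA hB with h | h
          · exact h ha
          · exact absurd (h hbB) hb
        simp [hbB, this]
      · simp only [hbB, if_false]
        split_ifs <;> positivity
    · simp only [ha, hb, if_true, if_false]
      positivity

/-- A flag can be recovered from its point and its sizes, so distinct flags of equal sizes have
distinct points. -/
theorem topSets_flagPoint {C : Finset (Finset ι)} (hC : IsFlag C) :
    topSets (flagSizes C) (flagPoint C) = C := by
  ext A
  rw [mem_topSets]
  constructor
  · rintro ⟨h1, h2⟩
    obtain ⟨B, hB, h⟩ := Finset.mem_image.mp h1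
    have hB' := isTop_flagPoint hC hB
    rwa [(h2.subset hB' h.ge).antisymm (hB'.subset h2 h.le)]
  · exact fun hA => ⟨Finset.mem_image_of_mem _ hA, isTop_flagPoint hC hA⟩

omit [Fintype ι] in
theorem hasGaps_flagPoint {C : Finset (Finset ι)} (hC : IsFlag C) :
    HasGaps (flagSizes C) (flagPoint C) := by
  intro s hs
  obtain ⟨A, hA, rfl⟩ := Finset.mem_image.mp hs
  exact ⟨A, rfl, isTop_flagPoint hC hA⟩

theorem IsFlag.eq_of_flagPoint_eq {C C' : Finset (Finset ι)} (hC : IsFlag C) (hC' : IsFlag C')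
    (hs : flagSizes C = flagSizes C') (h : flagPoint C = flagPoint C') : C = C' := by
  rw [← topSets_flagPoint hC, ← topSets_flagPoint hC', hs, h]

omit [DecidableEq ι] [DecidableEq κ] [Fintype ι] [Fintype κ] in
theorem mem_pushFlag {f : κ ↪ ι} {C : Finset (Finset κ)} {A : Finset ι} :
    A ∈ pushFlag f C ↔ ∃ B ∈ C, B.map f = A := by
  simp [pushFlag]

omit [DecidableEq ι] [DecidableEq κ] [Fintype ι] [Fintype κ] in
theorem isFlag_pushFlag {f : κ ↪ ι} {C : Finset (Finset κ)} :
    IsFlag (pushFlag f C) ↔ IsFlag C := by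
  constructor
  · rintro ⟨h1, h2⟩
    refine ⟨fun A hA B hB _ => ?_, fun A hA => ?_⟩
    · have := h1.total (mem_pushFlag.mpr ⟨A, hA, rfl⟩) (mem_pushFlag.mpr ⟨B, hB, rfl⟩)
      simpa using this
    · simpa using h2 _ (mem_pushFlag.mpr ⟨A, hA, rfl⟩)
  · rintro ⟨h1, h2⟩
    refine ⟨fun A hA B hB _ => ?_, fun A hA => ?_⟩
    · obtain ⟨A', hA', rfl⟩ := mem_pushFlag.mp hA
      obtain ⟨B', hB', rfl⟩ := mem_pushFlag.mp hB
      have := h1.total hA' hB'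
      simpa using this
    · obtain ⟨A', hA', rfl⟩ := mem_pushFlag.mp hA
      simpa using h2 A' hA'

omit [DecidableEq ι] [DecidableEq κ] [Fintype ι] [Fintype κ] in
theorem flagSizes_pushFlag (f : κ ↪ ι) (C : Finset (Finset κ)) :
    flagSizes (pushFlag f C) = flagSizes C := by
  ext s
  simp [flagSizes, mem_pushFlag]

omit [Fintype ι] [Fintype κ] in
theorem sup_pushFlag (f : κ ↪ ι) (C : Finset (Finset κ)) :
    (pushFlag f C).sup id = (C.sup id).map f := by
  ext a
  simp only [Finset.mem_sup, mem_pushFlag, id, Finset.mem_map]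
  constructor
  · rintro ⟨_, ⟨B, hB, rfl⟩, ha⟩
    obtain ⟨b, hb, rfl⟩ := Finset.mem_map.mp ha
    exact ⟨b, ⟨B, hB, hb⟩, rfl⟩
  · rintro ⟨b, ⟨B, hB, hb⟩, rfl⟩
    exact ⟨_, ⟨B, hB, rfl⟩, Finset.mem_map_of_mem f hb⟩

omit [Fintype ι] [Fintype κ] in
theorem flagPoint_pushFlag_apply (f : κ ↪ ι) (C : Finset (Finset κ)) (l : κ) :
    flagPoint (pushFlag f C) (f l) = flagPoint C l := by
  simp [flagPoint, pushFlag]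

omit [Fintype ι] [Fintype κ] [DecidableEq κ] in
theorem flagPoint_pushFlag_of_notMem (f : κ ↪ ι) (C : Finset (Finset κ)) {k : ι}
    (hk : k ∉ range f) : flagPoint (pushFlag f C) k = 0 := by
  refine Finset.sum_eq_zero fun A hA => ?_
  obtain ⟨B, -, rfl⟩ := mem_pushFlag.mp hA
  rw [if_neg]
  intro h
  obtain ⟨b, -, rfl⟩ := Finset.mem_map.mp h
  exact hk (mem_range_self b)

omit [DecidableEq ι] [DecidableEq κ] [Fintype ι] [Fintype κ] in
theorem pushFlag_pushFlag {μ : Type} (f : κ ↪ ι) (g : ι ↪ μ) (C : Finset (Finset κ)) :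
    pushFlag g (pushFlag f C) = pushFlag (f.trans g) C := by
  ext A
  simp [mem_pushFlag, Finset.map_map]

omit [DecidableEq ι] [DecidableEq κ] [Fintype ι] [Fintype κ] in
theorem pushFlag_injective (f : κ ↪ ι) : Function.Injective (pushFlag f) :=
  Finset.map_injective _

omit [Fintype ι] in
/-- Every flag comes from a flag that contains the full vertex set. -/
theorem exists_pushFlag_eq {C : Finset (Finset ι)} (hC : IsFlag C) {j : ℕ}
    (hj : (C.sup id).card = j) : ∃ (f : Fin j ↪ ι) (C' : Finset (Finset (Fin j))),
      pushFlag f C' = C ∧ IsFlag C' ∧ C'.sup id = Finset.univ := by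
  obtain ⟨e⟩ : Nonempty (Fin j ≃ (C.sup id : Finset ι)) :=
    ⟨(Finset.equivFinOfCardEq hj).symm⟩
  let f : Fin j ↪ ι := e.toEmbedding.trans (Function.Embedding.subtype _)
  have hf : ∀ a ∈ C.sup id, ∃ i, f i = a := fun a ha => ⟨e.symm ⟨a, ha⟩, by simp [f]⟩
  have hpush : pushFlag f (C.image fun A => Finset.univ.filter fun i => f i ∈ A) = C := by
    ext A
    have key : ∀ B ∈ C, (Finset.univ.filter fun i => f i ∈ B).map f = B := by
      intro B hB
      ext a
      simp only [Finset.mem_map, Finset.mem_filter, Finset.mem_univ, true_and]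
      constructor
      · rintro ⟨i, hi, rfl⟩
        exact hi
      · intro ha
        obtain ⟨i, rfl⟩ := hf a (Finset.mem_sup.mpr ⟨B, hB, ha⟩)
        exact ⟨i, ha, rfl⟩
    rw [mem_pushFlag]
    constructor
    · rintro ⟨_, hB, rfl⟩
      obtain ⟨B, hB', rfl⟩ := Finset.mem_image.mp hB
      rwa [key B hB']
    · exact fun hA => ⟨_, Finset.mem_image_of_mem _ hA, key A hA⟩
  refine ⟨f, _, hpush, ?_, ?_⟩
  · rwa [← isFlag_pushFlag (f := f), hpush]
  · refine Finset.map_injective f ?_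
    rw [← sup_pushFlag, hpush]
    ext a
    simp only [Finset.mem_map, Finset.mem_univ, true_and]
    exact ⟨hf a, by rintro ⟨i, rfl⟩; exact (e i).2⟩

omit [Fintype ι] in
theorem IsFlag.card_sup {C : Finset (Finset ι)} (hC : IsFlag C) :
    (C.sup id).card = (flagSizes C).sup id := by
  rcases C.eq_empty_or_nonempty with rfl | hne
  · rfl
  refine le_antisymm (Finset.le_sup (f := id) (Finset.mem_image_of_mem _ (hC.sup_mem hne)))
    (Finset.sup_le fun s hs => ?_)
  obtain ⟨A, hA, rfl⟩ := Finset.mem_image.mp hs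
  exact Finset.card_le_card (Finset.le_sup (f := id) hA)

omit [DecidableEq ι] [Fintype ι] in
theorem IsFlag.card_flagSizes {C : Finset (Finset ι)} (hC : IsFlag C) :
    (flagSizes C).card = C.card :=
  Finset.card_image_of_injOn fun _ hA _ hB h => hC.eq_of_card_eq hA hB h

/-! #### Symmetry -/

omit [Fintype ι] [DecidableEq ι] in
theorem isTop_map {g : Equiv.Perm ι} {x y : ι → ℝ} (h : ∀ l, y (g l) = x l) (A : Finset ι) :
    IsTopSet y (A.map g.toEmbedding) ↔ IsTopSet x A := by
  constructor
  · intro hA a ha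
    have := hA (g a) (Finset.mem_map_of_mem _ ha)
    rw [h] at this
    refine ⟨this.1, fun b hb => ?_⟩
    rw [← h]
    exact this.2 _ (by simpa using hb)
  · intro hA _ hga
    obtain ⟨a, ha, rfl⟩ := Finset.mem_map.mp hga
    refine ⟨by simpa [h] using (hA a ha).1, fun b hb => ?_⟩
    obtain ⟨b, rfl⟩ := g.surjective b
    have := (hA a ha).2 b (by simpa using hb)
    simpa [h] using this

omit [DecidableEq ι] in
theorem topSets_map {g : Equiv.Perm ι} {x y : ι → ℝ} (h : ∀ l, y (g l) = x l) (S : Finset ℕ) :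
    topSets S y = pushFlag g.toEmbedding (topSets S x) := by
  ext A
  rw [mem_pushFlag]
  have hA : (A.map g.symm.toEmbedding).map g.toEmbedding = A := by
    ext a
    simp
  constructor
  · intro hm
    refine ⟨A.map g.symm.toEmbedding, ?_, hA⟩
    rw [mem_topSets] at hm ⊢
    rw [Finset.card_map, ← isTop_map h, hA]
    exact hm
  · rintro ⟨B, hB, rfl⟩
    rw [mem_topSets] at hB ⊢
    rw [Finset.card_map, isTop_map h]
    exact hB

omit [Fintype ι] [DecidableEq ι] in
theorem hasGaps_map {g : Equiv.Perm ι} {x y : ι → ℝ} (h : ∀ l, y (g l) = x l) (S : Finset ℕ) :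
    HasGaps S y ↔ HasGaps S x := by
  refine forall₂_congr fun s _ => ?_
  constructor
  · rintro ⟨A, rfl, hA⟩
    refine ⟨A.map g.symm.toEmbedding, Finset.card_map _, ?_⟩
    rw [← isTop_map h]
    convert hA
    ext a
    simp
  · rintro ⟨A, rfl, hA⟩
    exact ⟨A.map g.toEmbedding, Finset.card_map _, (isTop_map h A).mpr hA⟩

/-! #### The deformation -/

open Classical in
/-- The straight-line deformation of the points with gaps `S` to the points of flags. -/
noncomputable def slide (S : Finset ℕ) (t : unitInterval) (x : stdSimplex ℝ ι) : stdSimplex ℝ ι :=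
  if h : (S.Nonempty ∧ 0 ∉ S) ∧ HasGaps S x then
    ⟨(1 - (t : ℝ)) • (x : ι → ℝ) + (t : ℝ) • flagPoint (topSets S x), by
      refine convex_stdSimplex ℝ ι x.2 (flagPoint_mem_stdSimplex (isFlag_topSets h.1.2 x) ?_)
        (sub_nonneg.mpr t.2.2) t.2.1 (by ring)
      have := h.1.1
      rw [← flagSizes_topSets h.2] at this
      exact Finset.image_nonempty.mp this⟩
  -- The identity is a default value that respects the glueing, so that the map descends to the
  -- whole quotient.
  else x

variable {S : Finset ℕ} (hS : S.Nonempty ∧ 0 ∉ S)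

include hS in
theorem slide_apply {x : stdSimplex ℝ ι} (hx : HasGaps S x) (t : unitInterval) (l : ι) :
    slide S t x l = (1 - (t : ℝ)) * x l + t * flagPoint (topSets S x) l := by
  rw [slide, dif_pos ⟨hS, hx⟩]
  rfl

theorem slide_zero (x : stdSimplex ℝ ι) : slide S 0 x = x := by
  rw [slide]
  split_ifs
  · ext l
    simp
    rfl
  · rfl

include hS in
-- Both ends of the segment satisfy the same strict inequalities, which are preserved by convex
-- combinations.
theorem isTop_slide {x : stdSimplex ℝ ι} (hx : HasGaps S x) (t : unitInterval) {A : Finset ι}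
    (hA : A ∈ topSets S x) : IsTopSet (slide S t x) A := by
  have h1 := (mem_topSets.mp hA).2
  have h2 := isTop_flagPoint (isFlag_topSets hS.2 x) hA
  have ht0 : (0 : ℝ) ≤ t := t.2.1
  have ht1 : (0 : ℝ) ≤ 1 - t := sub_nonneg.mpr t.2.2
  have key : ∀ u v : ℝ, 0 < u → 0 < v → 0 < (1 - (t : ℝ)) * u + t * v := by
    intro u v hu hv
    rcases ht0.eq_or_lt with h | h
    · rw [← h]
      simpa using hu
    · have := mul_pos h hv
      have := mul_nonneg ht1 hu.le
      linarith
  intro a ha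
  refine ⟨?_, fun b hb => ?_⟩
  · rw [slide_apply hS hx]
    exact key _ _ (h1 a ha).1 (h2 a ha).1
  · rw [slide_apply hS hx, slide_apply hS hx]
    have := key _ _ (sub_pos.mpr ((h1 a ha).2 b hb)) (sub_pos.mpr ((h2 a ha).2 b hb))
    linarith

include hS in
theorem hasGaps_slide {x : stdSimplex ℝ ι} (hx : HasGaps S x) (t : unitInterval) :
    HasGaps S (slide S t x) := by
  intro s hs
  obtain ⟨A, rfl, hA⟩ := hx s hs
  exact ⟨A, rfl, isTop_slide hS hx t (mem_topSets.mpr ⟨hs, hA⟩)⟩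

/-- Equivariance under relabelling of vertices, together with the preservation of facets in
`slide_eq_zero`, makes the deformation compatible with the glueing. -/
theorem slide_map {g : Equiv.Perm ι} {x y : stdSimplex ℝ ι} (h : ∀ l, y (g l) = x l)
    (t : unitInterval) (l : ι) : slide S t y (g l) = slide S t x l := by
  by_cases hc : (S.Nonempty ∧ 0 ∉ S) ∧ HasGaps S x
  · have := flagPoint_pushFlag_apply g.toEmbedding (topSets S x) l
    rw [slide_apply hc.1 hc.2, slide_apply hc.1 ((hasGaps_map h S).mpr hc.2), h,
      topSets_map h, ← this]
    rfl
  · rw [slide, slide, dif_neg hc, dif_neg (by rwa [hasGaps_map h]), h]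

theorem slide_eq_zero {x : stdSimplex ℝ ι} {k : ι} (hk : x k = 0) (t : unitInterval) :
    slide S t x k = 0 := by
  by_cases hc : (S.Nonempty ∧ 0 ∉ S) ∧ HasGaps S x
  · have : flagPoint (topSets S x) k = 0 := by
      refine Finset.sum_eq_zero fun A hA => if_neg fun hkA => ?_
      exact ((mem_topSets.mp hA).2 k hkA).1.ne' hk
    rw [slide_apply hc.1 hc.2, hk, this]
    simp
  · rw [slide, dif_neg hc, hk]

omit [DecidableEq ι] in
theorem isOpen_isTop (A : Finset ι) : IsOpen {x : stdSimplex ℝ ι | IsTopSet x A} := by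
  have hc : ∀ i, Continuous fun x : stdSimplex ℝ ι => x i := fun i =>
    (continuous_apply i).comp continuous_subtype_val
  simp only [IsTopSet, ofPred_forall, ofPred_and]
  exact isOpen_iInter_of_finite fun a => isOpen_iInter_of_finite fun _ =>
    (isOpen_lt continuous_const (hc a)).inter
      (isOpen_iInter_of_finite fun b => isOpen_iInter_of_finite fun _ => isOpen_lt (hc b) (hc a))

omit [DecidableEq ι] in
-- The defining inequalities are open, and uniqueness for each size excludes new sets nearby. Thus
-- the target of the deformation is locally constant.
theorem isOpen_topSets_eq (x : stdSimplex ℝ ι) (hx : HasGaps S x) :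
    ∃ U : Set (stdSimplex ℝ ι), IsOpen U ∧ x ∈ U ∧ ∀ y ∈ U, topSets S y = topSets S x := by
  refine ⟨⋂ A ∈ topSets S x, {y | IsTopSet y A}, isOpen_biInter_finset fun A _ => isOpen_isTop A,
    by simp only [mem_iInter]; exact fun A hA => (mem_topSets.mp hA).2, fun y hy => ?_⟩
  simp only [mem_iInter] at hy
  ext A
  constructor
  · intro hA
    have hA' := mem_topSets.mp hA
    obtain ⟨B, hB, hBx⟩ := hx A.card hA'.1
    have hBm : B ∈ topSets S x := mem_topSets.mpr ⟨hB ▸ hA'.1, hBx⟩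
    have hBy : IsTopSet y B := hy B hBm
    rwa [(hA'.2.subset hBy hB.ge).antisymm (hBy.subset hA'.2 hB.le)]
  · exact fun hA => mem_topSets.mpr ⟨(mem_topSets.mp hA).1, hy A hA⟩

include hS in
theorem continuous_slide {Y : Type} [TopologicalSpace Y] {u : Y → unitInterval}
    {v : Y → stdSimplex ℝ ι} (hu : Continuous u) (hv : Continuous v)
    (hg : ∀ y, HasGaps S (v y)) : Continuous fun y => slide S (u y) (v y) := by
  have hloc : IsLocallyConstant fun y => flagPoint (topSets S (v y)) := by
    refine (IsLocallyConstant.iff_exists_open _).mpr fun y => ?_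
    obtain ⟨U, hU, hyU, h⟩ := isOpen_topSets_eq (v y) (hg y)
    exact ⟨v ⁻¹' U, hU.preimage hv, hyU, fun z hz => by rw [h _ hz]⟩
  have hc := hloc.continuous
  have : (fun y => slide S (u y) (v y)) = fun y =>
      (⟨(1 - (u y : ℝ)) • (v y : ι → ℝ) + (u y : ℝ) • flagPoint (topSets S (v y)), by
        have := (slide S (u y) (v y)).2
        rwa [slide, dif_pos ⟨hS, hg y⟩] at this⟩ : stdSimplex ℝ ι) := by
    ext1 y
    exact dif_pos ⟨hS, hg y⟩
  rw [this]
  refine Continuous.subtype_mk ?_ _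
  fun_prop

omit [DecidableEq ι] in
/-- Every point of the simplex has a gap. -/
theorem exists_hasGaps [Nonempty ι] (x : stdSimplex ℝ ι) :
    ∃ s ∈ Finset.Icc 1 (Fintype.card ι), HasGaps {s} x := by
  classical
  obtain ⟨a, -, ha⟩ := Finset.exists_max_image (Finset.univ : Finset ι) x ⟨Classical.arbitrary ι,
    Finset.mem_univ _⟩
  have hpos : 0 < x a := by
    by_contra h
    have : ∑ i, x i ≤ 0 := Finset.sum_nonpos fun i hi => (ha i hi).trans (not_lt.mp h)
    rw [stdSimplex.sum_eq_one] at this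
    linarith
  -- The coordinates that attain the maximum, which is positive because the sum is `1`.
  set A : Finset ι := Finset.univ.filter fun i => x i = x a with hA
  refine ⟨A.card, Finset.mem_Icc.mpr ⟨Finset.card_pos.mpr ⟨a, by simp [hA]⟩, Finset.card_le_univ A⟩,
    ?_⟩
  intro s hs
  rw [Finset.mem_singleton] at hs
  refine ⟨A, hs.symm, fun i hi => ?_⟩
  rw [(Finset.mem_filter.mp hi).2]
  refine ⟨hpos, fun b hb => lt_of_le_of_ne (ha b (Finset.mem_univ b)) fun h => hb ?_⟩
  simpa [hA] using h

end Simplex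

/-! ### The Euler characteristic of a glued space as an alternating sum -/

namespace FacetPairing

variable {n m : ℕ} (T : FacetPairing n m)

variable {T} in
theorem Rel.symm {a b : Fin m × stdSimplex ℝ (Fin (n + 1))} (h : T.Rel a b) : T.Rel b a := by
  obtain ⟨k, hk, hb, hl⟩ := h
  have hpair : T.pair (a.1, k) = (b.1, (T.pair (a.1, k)).2) := by rw [hb]
  refine ⟨(T.pair (a.1, k)).2, ?_, ?_, fun l => ?_⟩
  · rw [← T.glue_opposite, hl, hk]
  · rw [← hpair, T.pair_pair]
  · rw [← hpair, T.glue_pair, ← hl]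
    simp

/-- The points of the glued space that have the gaps `S` in some (every) simplex. -/
def gapSet (S : Finset ℕ) : Set T.Realization :=
  {q | Quot.lift (fun a : Fin m × stdSimplex ℝ (Fin (n + 1)) => HasGaps S (a.2 : Fin (n + 1) → ℝ))
    (fun _ _ ⟨_, _, _, h⟩ => propext (hasGaps_map h S).symm) q}

variable {T} in
theorem mk_mem_gapSet {S : Finset ℕ} {a : Fin m × stdSimplex ℝ (Fin (n + 1))} :
    (Quot.mk _ a : T.Realization) ∈ T.gapSet S ↔ HasGaps S (a.2 : Fin (n + 1) → ℝ) :=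
  Iff.rfl

/-- The points of the glued space that belong to flags with sizes `S`. -/
def flagPoints (S : Finset ℕ) : Set T.Realization :=
  {q | ∃ (a : Fin m × stdSimplex ℝ (Fin (n + 1))) (C : Finset (Finset (Fin (n + 1)))),
    IsFlag C ∧ flagSizes C = S ∧ (a.2 : Fin (n + 1) → ℝ) = flagPoint C ∧ Quot.mk _ a = q}

theorem isOpen_gapSet (S : Finset ℕ) : IsOpen (T.gapSet S) := by
  rw [← isQuotientMap_quot_mk.isOpen_preimage]
  have : IsOpen {x : stdSimplex ℝ (Fin (n + 1)) | HasGaps S (x : Fin (n + 1) → ℝ)} := by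
    refine isOpen_iff_forall_mem_open.mpr fun x hx => ?_
    obtain ⟨U, hU, hxU, h⟩ := isOpen_topSets_eq x hx
    refine ⟨U, fun y hy s hs => ?_, hU, hxU⟩
    obtain ⟨A, rfl, hA⟩ := hx s hs
    have : A ∈ topSets S y := by
      rw [h y hy]
      exact mem_topSets.mpr ⟨hs, hA⟩
    exact ⟨A, rfl, (mem_topSets.mp this).2⟩
  exact this.preimage continuous_snd

theorem iUnion_gapSet : ⋃ s ∈ Finset.Icc 1 (n + 1), T.gapSet {s} = univ := by
  refine eq_univ_of_forall fun q => ?_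
  induction q using Quot.ind with | _ a
  obtain ⟨s, hs, h⟩ := exists_hasGaps a.2
  rw [Fintype.card_fin] at hs
  exact mem_biUnion hs h

theorem iInter_gapSet (S : Finset ℕ) : ⋂ s ∈ S, T.gapSet {s} = T.gapSet S := by
  ext q
  induction q using Quot.ind with | _ a
  simp [mk_mem_gapSet, HasGaps]

/-- The deformation of the simplices, on the glued space. -/
noncomputable def slideMap (S : Finset ℕ) (t : unitInterval) : T.Realization → T.Realization :=
  Quot.map (fun a => (a.1, slide S t a.2)) fun _ _ ⟨k, hk, hb, hl⟩ =>
    ⟨k, slide_eq_zero hk t, hb, slide_map hl t⟩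

theorem nonempty_deformationRetraction {S : Finset ℕ} (hS : S.Nonempty ∧ 0 ∉ S) :
    Nonempty (DeformationRetraction (T.gapSet S) (T.flagPoints S)) := by
  refine ⟨⟨fun p => T.slideMap S p.1 p.2, ?_, ?_, ?_, ?_, ?_, ?_⟩⟩
  · have hq : IsQuotientMap ((T.gapSet S).restrictPreimage (Quot.mk T.Rel)) :=
      isQuotientMap_quot_mk.restrictPreimage_isOpen (T.isOpen_gapSet S)
    refine hq.continuous_lift_prod_right ?_
    have : Continuous fun p : unitInterval × (Quot.mk T.Rel ⁻¹' T.gapSet S) =>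
        (p.2.1.1, slide S p.1 p.2.1.2) :=
      (by fun_prop : Continuous fun p : unitInterval × (Quot.mk T.Rel ⁻¹' T.gapSet S) =>
        p.2.1.1).prodMk (continuous_slide hS continuous_fst (by fun_prop) fun p => p.2.2)
    exact continuous_quot_mk.comp this
  · rintro ⟨t, q, hq⟩
    induction q using Quot.ind with | _ a
    exact hasGaps_slide hS hq t
  · rintro ⟨q, hq⟩
    induction q using Quot.ind with | _ a
    change Quot.mk _ (a.1, slide S 0 a.2) = _
    rw [slide_zero]
  · rintro ⟨q, hq⟩
    induction q using Quot.ind with | _ a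
    refine ⟨(a.1, slide S 1 a.2), topSets S a.2, isFlag_topSets hS.2 _, flagSizes_topSets hq, ?_,
      rfl⟩
    ext l
    change slide S 1 a.2 l = _
    rw [slide_apply hS hq]
    simp
  · rintro _ ⟨a, C, hC, rfl, h, rfl⟩
    rw [mk_mem_gapSet, h]
    exact hasGaps_flagPoint hC
  · rintro ⟨_, hq⟩ ⟨a, C, hC, rfl, h, rfl⟩
    change Quot.mk _ (a.1, slide _ 1 a.2) = Quot.mk _ a
    congr 1
    refine Prod.ext rfl ?_
    ext l
    rw [slide_apply hS hq, h, topSets_flagPoint hC]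
    simp

theorem finite_flagPoints (S : Finset ℕ) : (T.flagPoints S).Finite := by
  refine (finite_range fun p : Fin m × {p : Finset (Finset (Fin (n + 1))) //
    flagPoint p ∈ stdSimplex ℝ (Fin (n + 1))} =>
    (Quot.mk _ (p.1, ⟨flagPoint p.2.1, p.2.2⟩) : T.Realization)).subset ?_
  rintro _ ⟨⟨i, x⟩, C, hC, -, h, rfl⟩
  have hC : flagPoint C ∈ stdSimplex ℝ (Fin (n + 1)) := by
    rw [← h]
    exact x.2
  refine ⟨(i, ⟨C, hC⟩), ?_⟩
  change Quot.mk _ (i, (⟨flagPoint C, hC⟩ : stdSimplex ℝ (Fin (n + 1)))) = _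
  congr
  exact h.symm

theorem hasEuler_realization [T1Space T.Realization] : HasEuler (singularComplex T.Realization)
    (∑ S ∈ (Finset.Icc 1 (n + 1)).powerset with S.Nonempty,
      (-1) ^ (S.card + 1) * ((T.flagPoints S).ncard : ℤ)) :=
  hasEuler_of_cover _ (fun s => T.gapSet {s}) (fun _ => T.isOpen_gapSet _) T.iUnion_gapSet
    T.flagPoints (fun S _ _ => T.finite_flagPoints S) fun S hS hne => by
      rw [T.iInter_gapSet]
      exact T.nonempty_deformationRetraction
        ⟨hne, fun h => by simpa using (Finset.mem_Icc.mp (hS h)).1⟩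

end FacetPairing

/-! ### Counting the points of flags -/

section

open scoped Pointwise

theorem exists_perm_trans_eq {κ ι : Type} [Fintype κ] {f f' : κ ↪ ι}
    (h : Finset.univ.map f = Finset.univ.map f') :
    ∃ g : Equiv.Perm κ, g.toEmbedding.trans f' = f := by
  have : ∀ a, ∃ b, f' b = f a := fun a => by
    have : f a ∈ Finset.univ.map f' := h ▸ Finset.mem_map_of_mem f (Finset.mem_univ a)
    simpa using this
  choose g hg using this
  have hinj : Function.Injective g := fun a b hab => f.injective (by rw [← hg, ← hg, hab])
  exact ⟨Equiv.ofBijective g (Finite.injective_iff_bijective.mp hinj), by ext a; exact hg a⟩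

/-! ### Permutations acting on flags -/

section

variable {V : Type} [Fintype V] [DecidableEq V]

omit [Fintype V] in
theorem smul_eq_pushFlag (g : Equiv.Perm V) (C : Finset (Finset V)) :
    g • C = pushFlag g.toEmbedding C := by
  ext A
  simp only [Finset.mem_smul_finset, mem_pushFlag]
  refine exists_congr fun B => and_congr_right fun _ => ?_
  have : g • B = B.map g.toEmbedding := by
    ext a
    simp only [Finset.mem_smul_finset, Finset.mem_map]
    rfl
  rw [this]

omit [Fintype V] in
-- The members of a flag have different sizes and permutations preserve sizes, so a fixed flag is
-- fixed member by member.
theorem IsFlag.smul_eq_iff {C : Finset (Finset V)} (hC : IsFlag C) (g : Equiv.Perm V) :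
    g • C = C ↔ ∀ B ∈ C, g • B = B := by
  constructor
  · intro h B hB
    refine hC.eq_of_card_eq ?_ hB (Finset.card_smul_finset g B)
    rw [← h]
    exact Finset.smul_mem_smul_finset hB
  · intro h
    ext A
    rw [Finset.mem_smul_finset]
    constructor
    · rintro ⟨B, hB, rfl⟩
      rwa [h B hB]
    · exact fun hA => ⟨A, hA, h A hA⟩

variable (V) in
/-- The flags that contain the full vertex set and have the sizes `S`, with the action of the
permutations of the vertices. -/
def fullFlags (S : Finset ℕ) : SubMulAction (Equiv.Perm V) (Finset (Finset V)) where
  carrier := {C | IsFlag C ∧ C.sup id = Finset.univ ∧ flagSizes C = S}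
  smul_mem' g C := by
    rintro ⟨h1, h2, h3⟩
    rw [smul_eq_pushFlag]
    exact ⟨isFlag_pushFlag.mpr h1, by rw [sup_pushFlag, h2, Finset.map_univ_equiv],
      by rw [flagSizes_pushFlag, h3]⟩

open Classical in
-- Flags are sorted by their sizes `S`. A flag has as many members as sizes, so its sign is constant
-- in each class; the exponent `S.card + 1` of inclusion-exclusion causes the minus sign.
theorem flagSum_univ_eq_neg_sum [Nonempty V] (p : Finset V → Prop) {N : ℕ}
    (hN : Fintype.card V ≤ N) : flagSum p (Finset.univ : Finset V) =
      - ∑ S ∈ (Finset.Icc 1 N).powerset with S.Nonempty ∧ S.sup id = Fintype.card V,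
        (-1) ^ (S.card + 1) * (((Finset.univ.filter fun C : Finset (Finset V) =>
          IsFlag C ∧ (∀ B ∈ C, p B) ∧ C.sup id = Finset.univ).filter
            fun C => flagSizes C = S).card : ℤ) := by
  rw [flagSum, ← Finset.sum_fiberwise_of_maps_to (g := flagSizes)
    (t := (Finset.Icc 1 N).powerset.filter fun S => S.Nonempty ∧ S.sup id = Fintype.card V),
    ← Finset.sum_neg_distrib]
  · refine Finset.sum_congr rfl fun S _ => ?_
    rw [Finset.sum_congr rfl (g := fun _ => (-1 : ℤ) ^ S.card), Finset.sum_const]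
    · rw [pow_succ, nsmul_eq_mul]
      ring
    · intro C hC
      rw [Finset.mem_filter, Finset.mem_filter] at hC
      rw [← hC.2, hC.1.2.1.card_flagSizes]
  · intro C hC
    obtain ⟨-, h1, -, h2⟩ := Finset.mem_filter.mp hC
    have hsup : (flagSizes C).sup id = Fintype.card V := by
      rw [← h1.card_sup, h2, Finset.card_univ]
    refine Finset.mem_filter.mpr ⟨Finset.mem_powerset.mpr fun s hs => ?_, ?_, hsup⟩
    · obtain ⟨A, hA, rfl⟩ := Finset.mem_image.mp hs
      exact Finset.mem_Icc.mpr ⟨(h1.2 A hA).card_pos, (Finset.card_le_univ A).trans hN⟩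
    · rw [Finset.nonempty_iff_ne_empty]
      intro h
      rw [h] at hsup
      exact Fintype.card_ne_zero hsup.symm

open Classical in
/-- The alternating number of full flags fixed by a permutation. -/
theorem sum_card_fixed_fullFlags [Nonempty V] (g : Equiv.Perm V) {N : ℕ} (hN : Fintype.card V ≤ N) :
    ∑ S ∈ (Finset.Icc 1 N).powerset with S.Nonempty ∧ S.sup id = Fintype.card V,
      (-1) ^ (S.card + 1) *
        (((Finset.univ : Finset (fullFlags V S)).filter fun C => g • C = C).card : ℤ) =
      - flagSum (fun B => g • B = B) (Finset.univ : Finset V) := by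
  rw [flagSum_univ_eq_neg_sum _ hN, neg_neg]
  refine Finset.sum_congr rfl fun S _ => ?_
  rw [← Finset.card_map (Function.Embedding.subtype _)]
  congr 3
  ext C
  simp only [Finset.mem_map, Finset.mem_filter, Finset.mem_univ, true_and,
    Function.Embedding.subtype_apply]
  constructor
  · rintro ⟨⟨C, h1, h2, h3⟩, hg, rfl⟩
    exact ⟨⟨h1, (h1.smul_eq_iff g).mp (congrArg Subtype.val hg), h2⟩, h3⟩
  · rintro ⟨⟨h1, hg, h2⟩, h3⟩
    exact ⟨⟨C, h1, h2, h3⟩, Subtype.ext ((h1.smul_eq_iff g).mpr hg), rfl⟩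

end

/-! ### Ordered cells of the glued space and orbit counting -/

namespace FacetPairing

variable {n m : ℕ} (T : FacetPairing n m) (j : ℕ)

/-- The identifications of ordered simplices: those of a facet are identified with those of the
paired facet. -/
def CellRel (a b : Fin m × (Fin j ↪ Fin (n + 1))) : Prop :=
  ∃ k ∉ range a.2, b = ((T.pair (a.1, k)).1, a.2.trans (T.glue (a.1, k)).toEmbedding)

/-- The ordered simplices with `j` vertices of the glued space. -/
abbrev Cell : Type := Quot (T.CellRel j)

noncomputable instance : Fintype (T.Cell j) := Fintype.ofFinite _

instance : MulAction (Equiv.Perm (Fin j)) (T.Cell j) where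
  smul g := Quot.map (fun a => (a.1, g⁻¹.toEmbedding.trans a.2)) (by
    rintro ⟨i, f⟩ _ ⟨k, hk, rfl⟩
    refine ⟨k, ?_, rfl⟩
    rintro ⟨l, hl⟩
    exact hk ⟨_, hl⟩)
  one_smul q := by
    induction q using Quot.ind
    rfl
  mul_smul g h q := by
    induction q using Quot.ind
    refine congrArg (Quot.mk _) (Prod.ext rfl ?_)
    ext l
    simp [mul_inv_rev]

variable {j}

theorem smul_mk (g : Equiv.Perm (Fin j)) (i : Fin m) (f : Fin j ↪ Fin (n + 1)) :
    g • (Quot.mk _ (i, f) : T.Cell j) = Quot.mk _ (i, g⁻¹.toEmbedding.trans f) := rfl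

variable {S : Finset ℕ}

theorem flagPoint_pushFlag_mem (hS : S.Nonempty) (C : fullFlags (Fin j) S)
    (f : Fin j ↪ Fin (n + 1)) : flagPoint (pushFlag f C.1) ∈ stdSimplex ℝ (Fin (n + 1)) := by
  refine flagPoint_mem_stdSimplex (isFlag_pushFlag.mpr C.2.1) ?_
  have := hS
  rw [← C.2.2.2, ← flagSizes_pushFlag f] at this
  exact Finset.image_nonempty.mp this

theorem flagPoint_pushFlag_trans_glue (i : Fin m) (f : Fin j ↪ Fin (n + 1)) (k : Fin (n + 1))
    (C : Finset (Finset (Fin j))) (l : Fin (n + 1)) :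
    flagPoint (pushFlag (f.trans (T.glue (i, k)).toEmbedding) C) (T.glue (i, k) l) =
      flagPoint (pushFlag f C) l := by
  rw [← pushFlag_pushFlag]
  exact flagPoint_pushFlag_apply (T.glue (i, k)).toEmbedding _ l

/-- The point of a flag in an ordered simplex. -/
noncomputable def cellPoint (hS : S.Nonempty) (z : T.Cell j × fullFlags (Fin j) S) :
    T.Realization :=
  Quot.lift (fun a : Fin m × (Fin j ↪ Fin (n + 1)) => (Quot.mk _
    (a.1, ⟨flagPoint (pushFlag a.2 z.2.1), flagPoint_pushFlag_mem hS z.2 a.2⟩) : T.Realization))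
    (by
      rintro ⟨i, f⟩ _ ⟨k, hk, rfl⟩
      exact Quot.sound ⟨k, flagPoint_pushFlag_of_notMem f _ hk, rfl,
        T.flagPoint_pushFlag_trans_glue i f k _⟩) z.1

theorem cellPoint_smul (hS : S.Nonempty) (g : Equiv.Perm (Fin j))
    (z : T.Cell j × fullFlags (Fin j) S) : T.cellPoint hS (g • z) = T.cellPoint hS z := by
  obtain ⟨q, C⟩ := z
  induction q using Quot.ind with | _ a
  refine congrArg (Quot.mk _) (Prod.ext rfl (Subtype.ext (congrArg flagPoint ?_)))
  change pushFlag (g⁻¹.toEmbedding.trans a.2) (g • C.1) = pushFlag a.2 C.1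
  rw [smul_eq_pushFlag, pushFlag_pushFlag]
  congr 1
  ext l
  simp

/-- The ordered simplices and flags that define a given point. -/
def preCells (S : Finset ℕ) (a : Fin m × stdSimplex ℝ (Fin (n + 1))) :
    Set (T.Cell j × fullFlags (Fin j) S) :=
  {z | ∃ f, z.1 = Quot.mk _ (a.1, f) ∧ (a.2 : Fin (n + 1) → ℝ) = flagPoint (pushFlag f z.2.1)}

variable {T} in
-- The flag contains the full set, so all vertices of the ordered simplex have positive coordinates.
-- A facet containing the point therefore contains the simplex, and the glueing carries both along.
theorem Rel.preCells_subset {a b : Fin m × stdSimplex ℝ (Fin (n + 1))} (h : T.Rel a b) :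
    T.preCells (j := j) S a ⊆ T.preCells S b := by
  obtain ⟨k, hk, hb, hl⟩ := h
  rintro ⟨q, C⟩ ⟨f, hq, hf⟩
  have hkf : k ∉ range f := by
    rintro ⟨l, rfl⟩
    have hlu : l ∈ C.1.sup id := by
      rw [C.2.2.1]
      exact Finset.mem_univ l
    obtain ⟨A, hA, hlA⟩ := Finset.mem_sup.mp hlu
    rw [hf, flagPoint_pushFlag_apply] at hk
    exact ((isTop_flagPoint C.2.1 hA) l hlA).1.ne' hk
  refine ⟨f.trans (T.glue (a.1, k)).toEmbedding, ?_, ?_⟩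
  · rw [hq, hb]
    exact Quot.sound ⟨k, hkf, rfl⟩
  · ext l
    obtain ⟨l, rfl⟩ := (T.glue (a.1, k)).surjective l
    rw [hl, hf]
    exact (T.flagPoint_pushFlag_trans_glue a.1 f k _ l).symm

/-- Since `preCells` descends to the glued space, equal points have the same representing pairs. Two
pairs within a single simplex give the same flag, hence the same vertex set, and differ by a
reordering of it. -/
theorem cellPoint_eq_iff (hS : S.Nonempty) (z z' : T.Cell j × fullFlags (Fin j) S) :
    T.cellPoint hS z = T.cellPoint hS z' ↔ ∃ g : Equiv.Perm (Fin j), g • z = z' := by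
  constructor
  · intro h
    let κ : T.Realization → Set (T.Cell j × fullFlags (Fin j) S) :=
      Quot.lift (T.preCells S) fun a b hab => hab.preCells_subset.antisymm hab.symm.preCells_subset
    have hκ : κ (T.cellPoint hS z) = κ (T.cellPoint hS z') := congrArg κ h
    have hz : z ∈ κ (T.cellPoint hS z) := by
      obtain ⟨q, C⟩ := z
      induction q using Quot.ind with | _ a
      exact ⟨a.2, rfl, rfl⟩
    rw [hκ] at hz
    obtain ⟨q', C'⟩ := z'
    obtain ⟨q, C⟩ := z
    induction q' using Quot.ind with | _ a
    obtain ⟨f, hq, hf⟩ := hz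
    have hC : pushFlag a.2 C'.1 = pushFlag f C.1 :=
      (isFlag_pushFlag.mpr C'.2.1).eq_of_flagPoint_eq (isFlag_pushFlag.mpr C.2.1)
        (by rw [flagSizes_pushFlag, flagSizes_pushFlag, C.2.2.2, C'.2.2.2]) hf
    have hr : Finset.univ.map f = Finset.univ.map a.2 := by
      rw [← C.2.2.1, ← sup_pushFlag, ← hC, sup_pushFlag, C'.2.2.1, C.2.2.1]
    obtain ⟨g, hg⟩ := exists_perm_trans_eq hr
    refine ⟨g, Prod.ext ?_ (Subtype.ext (pushFlag_injective a.2 ?_))⟩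
    · change g • q = _
      rw [show q = _ from hq, smul_mk, ← hg]
      refine congrArg (Quot.mk _) (Prod.ext rfl ?_)
      ext l
      simp
    · change pushFlag a.2 (g • C.1) = _
      rw [smul_eq_pushFlag, pushFlag_pushFlag, hg, hC]
  · rintro ⟨g, rfl⟩
    rw [cellPoint_smul]

theorem range_cellPoint (hS : S.Nonempty) (hj : S.sup id = j) :
    range (T.cellPoint (j := j) hS) = T.flagPoints S := by
  refine Subset.antisymm ?_ ?_
  · rintro _ ⟨⟨q, C⟩, rfl⟩
    induction q using Quot.ind with | _ a
    exact ⟨_, pushFlag a.2 C.1, isFlag_pushFlag.mpr C.2.1,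
      by rw [flagSizes_pushFlag, C.2.2.2], rfl, rfl⟩
  · rintro _ ⟨a, C, hC, rfl, h, rfl⟩
    obtain ⟨f, C', rfl, h1, h2⟩ := exists_pushFlag_eq hC (hC.card_sup.trans hj)
    refine ⟨(Quot.mk _ (a.1, f), ⟨C', h1, h2, (flagSizes_pushFlag f C').symm⟩), ?_⟩
    exact congrArg (Quot.mk _) (Prod.ext rfl (Subtype.ext h.symm))

open Classical in
-- The points are the orbits of pairs, and a pair is fixed exactly when both entries are; Burnside's
-- lemma applies.
theorem factorial_mul_ncard_flagPoints (hS : S.Nonempty) (hj : S.sup id = j) :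
    j.factorial * (T.flagPoints S).ncard = ∑ g : Equiv.Perm (Fin j),
      ((Finset.univ : Finset (T.Cell j)).filter fun q => g • q = q).card *
      ((Finset.univ : Finset (fullFlags (Fin j) S)).filter fun C => g • C = C).card := by
  have := card_mul_card_image_eq_sum _ (T.cellPoint_eq_iff (j := j) hS) Finset.univ
    fun _ _ _ => Finset.mem_univ _
  rw [Fintype.card_perm, Fintype.card_fin] at this
  rw [← T.range_cellPoint hS hj, ← image_univ, ← Finset.coe_univ, ← Finset.coe_image,
    ncard_coe_finset, this]
  refine Finset.sum_congr rfl fun g _ => ?_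
  rw [← Finset.card_product, ← Finset.filter_product, Finset.univ_product_univ]
  congr 1
  ext z
  simp [Prod.ext_iff]

open Classical in
-- By Burnside's lemma the sum is `j!` times the number of orbits. An orbit is a class of unordered
-- faces, and before glueing there are only `m * (n + 1).choose j` faces.
theorem sum_card_fixed_cells_le (j : ℕ) : ∑ g : Equiv.Perm (Fin j),
    ((Finset.univ : Finset (T.Cell j)).filter fun q => g • q = q).card ≤
      j.factorial * (m * (n + 1).choose j) := by
  let Ψ : T.Cell j → MulAction.orbitRel.Quotient (Equiv.Perm (Fin j)) (T.Cell j) :=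
    Quotient.mk _
  have hΨ : ∀ z z', Ψ z = Ψ z' ↔ ∃ g : Equiv.Perm (Fin j), g • z = z' := by
    intro z z'
    rw [eq_comm, Quotient.eq]
    exact MulAction.orbitRel_apply
  have := card_mul_card_image_eq_sum Ψ hΨ Finset.univ fun _ _ _ => Finset.mem_univ _
  rw [← this, Fintype.card_perm, Fintype.card_fin]
  refine Nat.mul_le_mul_left _ ?_
  have hsurj : ∀ q, ∃ a, Ψ (Quot.mk _ a) = q := by
    intro q
    induction q using Quotient.ind with | _ z
    induction z using Quot.ind with | _ a
    exact ⟨a, rfl⟩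
  choose a ha using hsurj
  have hcard : m * (n + 1).choose j = ((Finset.univ : Finset (Fin m)) ×ˢ
      (Finset.univ : Finset (Fin (n + 1))).powersetCard j).card := by
    simp
  rw [hcard]
  refine Finset.card_le_card_of_injOn (fun q => ((a q).1, Finset.univ.map (a q).2)) ?_ ?_
  · intro q _
    simp
  · intro q _ q' _ h
    obtain ⟨h1, h2⟩ := Prod.ext_iff.mp h
    obtain ⟨g, hg⟩ := exists_perm_trans_eq h2
    rw [← ha q, ← ha q', hΨ]
    refine ⟨g, ?_⟩
    change Quot.mk _ ((a q).1, g⁻¹.toEmbedding.trans (a q).2) = _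
    refine congrArg (Quot.mk _) (Prod.ext h1 ?_)
    rw [← hg]
    ext l
    simp

/-- The flags whose greatest members have `j` vertices contribute at most the number of
simplices with `j` vertices to the Euler characteristic. -/
theorem natAbs_sum_flagPoints_le {j : ℕ} (hj : j ∈ Finset.Icc 1 (n + 1)) :
    (∑ S ∈ (Finset.Icc 1 (n + 1)).powerset with S.Nonempty ∧ S.sup id = j,
      (-1) ^ (S.card + 1) * ((T.flagPoints S).ncard : ℤ)).natAbs ≤ m * (n + 1).choose j := by
  classical
  obtain ⟨hj0, hjn⟩ := Finset.mem_Icc.mp hj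
  have : Nonempty (Fin j) := ⟨⟨0, hj0⟩⟩
  -- With the sums interchanged, the fixed cells do not depend on `S`, and the inner sum is the
  -- alternating number of fixed flags.
  have key : (j.factorial : ℤ) *
      ∑ S ∈ (Finset.Icc 1 (n + 1)).powerset with S.Nonempty ∧ S.sup id = j,
        (-1) ^ (S.card + 1) * ((T.flagPoints S).ncard : ℤ) =
      ∑ g : Equiv.Perm (Fin j),
        (((Finset.univ : Finset (T.Cell j)).filter fun q => g • q = q).card : ℤ) *
          - flagSum (fun B => g • B = B) (Finset.univ : Finset (Fin j)) := by
    have hflag := fun g : Equiv.Perm (Fin j) =>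
      sum_card_fixed_fullFlags g (N := n + 1) ((Fintype.card_fin j).le.trans hjn)
    simp only [Fintype.card_fin] at hflag
    simp_rw [← hflag, Finset.mul_sum]
    rw [Finset.sum_comm]
    refine Finset.sum_congr rfl fun S hS => ?_
    obtain ⟨-, hne, hsup⟩ := Finset.mem_filter.mp hS
    have := congrArg (Nat.cast : ℕ → ℤ) (T.factorial_mul_ncard_flagPoints hne hsup)
    push_cast at this
    rw [mul_left_comm, this, Finset.mul_sum]
    exact Finset.sum_congr rfl fun g _ => mul_left_comm _ _ _
  refine Nat.le_of_mul_le_mul_left ?_ j.factorial_pos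
  refine le_trans ?_ (T.sum_card_fixed_cells_le j)
  rw [← Int.natAbs_natCast j.factorial, ← Int.natAbs_mul, key]
  refine (Int.natAbs_sum_le _ _).trans (Finset.sum_le_sum fun g _ => ?_)
  rw [Int.natAbs_mul, Int.natAbs_neg, natAbs_flagSum_smul g _ Finset.smul_finset_univ, mul_one,
    Int.natAbs_natCast]

/-- The Euler characteristic of the space glued from `m` simplices is at most `2 ^ (n + 1) * m` in
absolute value. -/
theorem exists_hasEuler_realization [T1Space T.Realization] :
    ∃ e, HasEuler (singularComplex T.Realization) e ∧ e.natAbs ≤ 2 ^ (n + 1) * m := by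
  refine ⟨_, T.hasEuler_realization, ?_⟩
  rw [← Finset.sum_fiberwise_of_maps_to (g := fun S : Finset ℕ => S.sup id)
    (t := Finset.Icc 1 (n + 1))]
  · refine (Int.natAbs_sum_le _ _).trans ?_
    calc _ ≤ ∑ j ∈ Finset.Icc 1 (n + 1), m * (n + 1).choose j :=
          Finset.sum_le_sum fun j hj => by
            rw [Finset.filter_filter]
            exact T.natAbs_sum_flagPoints_le hj
      -- The term `j = 0` is added to complete the row of binomial coefficients.
      _ ≤ ∑ j ∈ Finset.range (n + 1 + 1), m * (n + 1).choose j :=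
          Finset.sum_le_sum_of_subset fun j hj => by
            rw [Finset.mem_Icc] at hj
            rw [Finset.mem_range]
            omega
      _ = 2 ^ (n + 1) * m := by
          rw [← Finset.mul_sum, Nat.sum_range_choose, mul_comm]
  · intro S hS
    obtain ⟨hS, s, hs⟩ := Finset.mem_filter.mp hS
    rw [Finset.mem_powerset] at hS
    refine Finset.mem_Icc.mpr ⟨(Finset.mem_Icc.mp (hS hs)).1.trans (Finset.le_sup (f := id) hs),
      Finset.sup_le fun s hs => (Finset.mem_Icc.mp (hS hs)).2⟩

end FacetPairing

end

/-! ### The bound -/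

/-- The Euler characteristic of `M'` is computed twice, from the covering and from the
triangulation. The T1 property of the glued space comes from its homeomorphism with `M'`. -/
theorem natAbs_eulerCharacteristic_mul_le {n N N' m d : ℕ} {M : Set (Fin N → ℝ)}
    (hM : IsClosedPLManifold n M) {M' : Set (Fin N' → ℝ)} {p : M' → M} (hp : IsPLCovering p d)
    {T : FacetPairing n m} (hT : T.Triangulates M') :
    (eulerCharacteristic M).natAbs * d ≤ 2 ^ (n + 1) * m := by
  obtain ⟨h, -⟩ := hT
  have : T1Space T.Realization := h.symm.t1Space
  obtain ⟨e, he, hle⟩ := T.exists_hasEuler_realization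
  have h1 := he.of_homotopyEquiv h.toHomotopyEquiv
  have h2 := exists_hasEuler_covering hM.isCompactPolyhedron hp.isCoveringMap hp.degree_pos
    hp.ncard_fiber
  rw [h1.unique h2, Int.natAbs_mul, Int.natAbs_natCast, mul_comm] at hle
  exact hle

theorem mainTheorem9 (n N : ℕ) (M : Set (Fin N → ℝ)) (hM : IsClosedPLManifold n M) :
    ((eulerCharacteristic M).natAbs : ℝ≥0∞) ≤ 2 ^ (n + 1) * stableDeltaComplexity n M ∧
      (stableDeltaComplexity n M = 0 → eulerCharacteristic M = 0) := by
  have hpow0 : (2 : ℝ≥0∞) ^ (n + 1) ≠ 0 := pow_ne_zero _ two_ne_zero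
  have hpow : (2 : ℝ≥0∞) ^ (n + 1) ≠ ⊤ := ENNReal.pow_ne_top ENNReal.ofNat_ne_top
  have key : ((eulerCharacteristic M).natAbs : ℝ≥0∞) ≤ 2 ^ (n + 1) * stableDeltaComplexity n M := by
    rw [← ENNReal.div_le_iff' hpow0 hpow]
    refine le_iInf fun N' => le_iInf fun M' => le_iInf fun _ => le_iInf fun p => le_iInf fun d =>
      le_iInf fun hp => ?_
    have hd0 : (d : ℝ≥0∞) ≠ 0 := by exact_mod_cast hp.degree_pos.ne'
    rw [ENNReal.le_div_iff_mul_le (Or.inl hd0) (Or.inl (ENNReal.natCast_ne_top d))]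
    -- An infinite complexity makes the bound trivial.
    rcases eq_or_ne (deltaComplexity n M') ⊤ with h | h
    · simp [h]
    obtain ⟨m, hm⟩ := ENat.ne_top_iff_exists.mp h
    -- An infimum below `m + 1` yields a triangulation with at most `m` simplices.
    have hlt : deltaComplexity n M' < ((m + 1 : ℕ) : ℕ∞) := by
      rw [← hm]
      exact_mod_cast m.lt_succ_self
    simp only [deltaComplexity, iInf_lt_iff] at hlt
    obtain ⟨m', ⟨T, hT⟩, hlt⟩ := hlt
    have hle : (eulerCharacteristic M).natAbs * d ≤ 2 ^ (n + 1) * m :=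
      (natAbs_eulerCharacteristic_mul_le hM hp hT).trans
        (Nat.mul_le_mul_left _ (Nat.lt_succ_iff.mp (by exact_mod_cast hlt)))
    rw [← hm, ENat.toENNReal_coe, ENNReal.div_eq_inv_mul, mul_assoc, ← ENNReal.div_eq_inv_mul,
      ENNReal.div_le_iff' hpow0 hpow]
    exact_mod_cast hle
  refine ⟨key, fun h => ?_⟩
  rw [h, mul_zero, nonpos_iff_eq_zero, Nat.cast_eq_zero, Int.natAbs_eq_zero] at key
  exact key
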